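/- Let $L=\{+,-,1\}\cup\{R_r(x,y): r\in\mathbb{Q}^+\}$ and let $T$ be the complete theory of $(\mathbb{R},+,-,1,R_r)_{r\in\mathbb{Q}^+}$, where $R_r(x,y)$ holds in $\mathbb{R}$ iff $0\le y-x\le r$. Let $\mathfrak{C}\prec\mathfrak{C}'$ be models of $T$ such that $\mathfrak{C}$ is $\kappa$-saturated for a strong limit cardinal $\kappa>|T|=\aleph_0$, and $\mathfrak{C}'$ is $\kappa'$-saturated and strongly $\kappa'$-homogeneous for a strong limit cardinal $\kappa'>|\mathfrak{C}|$. A set is called $\mathfrak{C}$-small if it has fewer than $\kappa$ elements. Let $p\in S_1(\mathfrak{C})$ be the complete ($\emptyset$-invariant) type determined by $\{\neg R_r(x,c)\wedge\neg R_r(c,x): c\in\mathfrak{C},\ r\in\mathbb{Q}^+\}$, let $p(\mathfrak{C}')$ be its set of realizations in $\mathfrak{C}'$, and let $E$ be the equivalence relation on $p(\mathfrak{C}')$ of equality modulo infinitesimals: $$x\,E\,y\iff R_r(x,y)\vee R_r(y,x)\ \text{ for all } r\in\mathbb{Q}^+ .$$ An equivalence relation $F$ on $p(\mathfrak{C}')$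 is relatively type-definable over $B\subseteq\mathfrak{C}$ if $F=\pi(\mathfrak{C}',\mathfrak{C}')\cap p(\mathfrak{C}')^2$ for some partial type $\pi(x,y)$ over $B$. For such $F$, the quotient $p(\mathfrak{C}')/F$ is stable if for every $\mathfrak{C}$-indiscernible sequence $(a_i,b_i)_{i<\omega}$ with $a_i\in p(\mathfrak{C}')/F$ and $b_i$ tuples of length $<\kappa'$ from $\mathfrak{C}'$ one has $\mathrm{tp}(a_i,b_j/\mathfrak{C})=\mathrm{tp}(a_j,b_i/\mathfrak{C})$ for all $i\ne j$; here types over $\mathfrak{C}$ are orbits under $\mathrm{Aut}(\mathfrak{C}'/\mathfrak{C})$. Then $E$ is the finest equivalence relation on $p(\mathfrak{C}')$ that is relatively type-definable over a $\mathfrak{C}$-small subset of $\mathfrak{C}$ and has stable quotient; that is, $E$ itself is such a relation, and $E\subseteq F$ for every such relation $F$ (so $E^{st}=E$). Moreover, for every non-empty $\mathfrak{C}$-small set $A$ of positive infinitesimals of $\mathfrak{C}$, the quotient $p(\mathfrak{C}')/E_A$ is not stable, where $x\,E_A\,y$ iff $|x-y|\le\frac1n a$ for all $a\in A$ and $n\ge1$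 (expressed in $L$ by $R_1(n(x-y),a)\wedge R_1(n(y-x),a)$). -/

import Mathlib

open FirstOrder FirstOrder.Language Cardinal

universe u

/-! ## Monster models, types and hyperdefinable sets -/

namespace HyperStable

section General

variable (L : FirstOrder.Language.{0, 0})

/-- `κ`-saturation: every finitely satisfiable set of formulas in one variable over fewer than `κ`
parameters is realized. -/
def IsSaturated (κ : Cardinal.{u}) (M : Type u) [L.Structure M] : Prop :=
  ∀ A : Set M, #A < κ → ∀ S : Set (L[[A]].Formula Unit),
    (∀ s : Finset (L[[A]].Formula Unit), (s : Set (L[[A]].Formula Unit)) ⊆ S →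
      ∃ a : M, ∀ φ ∈ s, φ.Realize (fun _ => a)) →
    ∃ a : M, ∀ φ ∈ S, φ.Realize (fun _ => a)

/-- Strong `κ`-homogeneity: every partial elementary map with domain of size less than `κ` extends
to an automorphism. -/
def IsStronglyHomogeneous (κ : Cardinal.{u}) (N : Type u) [L.Structure N] : Prop :=
  ∀ A : Set N, #A < κ → ∀ f : A → N,
    (∀ φ : L.Formula A, φ.Realize (fun a => (a : N)) ↔ φ.Realize f) →
    ∃ σ : N ≃[L] N, ∀ a : A, σ a = f a

variable {L} {N : Type u} [L.Structure N]

/-- The space of complete `1`-types over the set of parameters `A` of the structure `N`. -/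
abbrev TypeOver [Nonempty N] (A : Set N) : Type u :=
  (L[[A]].completeTheory N).CompleteType Unit

/-- The set of realizations in `N` of a complete `1`-type over `A ⊆ N`. -/
def realizations [Nonempty N] {A : Set N} (p : TypeOver (L := L) A) : Set N :=
  {a | ∀ φ : L[[A]].Formula Unit, Formula.equivSentence φ ∈ p → φ.Realize (fun _ => a)}

variable (L) in
/-- The relation `F` on `X` is relatively type-definable over `B`: it is relatively defined by a
partial type `π(x, y)` with parameters from `B`. -/
def IsRelTypeDefOver (B : Set N) {X : Set N} (F : Setoid X) : Prop :=
  ∃ π : Set (L[[B]].Formula (Fin 2)),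
    ∀ x y : X, F x y ↔ ∀ φ ∈ π, φ.Realize ![(x : N), (y : N)]

/-- The subset of `N` underlying an element of the quotient `X/F`. -/
def classSet {X : Set N} {F : Setoid X} (q : Quotient F) : Set N :=
  Subtype.val '' {x : X | Quotient.mk F x = q}

variable (L) in
/-- Two families consisting of elements of `X/F` and of tuples from `N` have the same complete
type over `A`, i.e. they lie in the same orbit of `Aut(N/A)`. -/
def SameType (A : Set N) {X : Set N} {F : Setoid X} {ι : Type} {β : Type u}
    (a a' : ι → Quotient F) (b b' : ι → β → N) : Prop :=
  ∃ σ : N ≃[L] N, (∀ c ∈ A, σ c = c) ∧ (∀ i, σ '' classSet (a i) = classSet (a' i)) ∧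
    ∀ i k, σ (b i k) = b' i k

variable (L) in
/-- `A`-indiscernibility of a sequence `(a_i, b_i)_{i<ω}` with `a_i ∈ X/F` and `b_i` a tuple
from `N`. -/
def IsIndiscernible (A : Set N) {X : Set N} {F : Setoid X} {β : Type u}
    (a : ℕ → Quotient F) (b : ℕ → β → N) : Prop :=
  ∀ (n : ℕ) (f g : Fin n → ℕ), StrictMono f → StrictMono g →
    SameType L A (fun k => a (f k)) (fun k => a (g k)) (fun k => b (f k)) (fun k => b (g k))

variable (L) in
/-- Stability of the set `X/F` (hyperdefinable over `A`) in the monster model `N` with degree of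
saturation `κ'`: for every `A`-indiscernible sequence `(a_i, b_i)_{i<ω}` with `a_i ∈ X/F` (and
`b_i` small tuples) one has `tp(a_i, b_j/A) = tp(a_j, b_i/A)` for all `i ≠ j`. -/
def IsStableQuotient (κ' : Cardinal.{u}) (A : Set N) {X : Set N} (F : Setoid X) : Prop :=
  ∀ (β : Type u), #β < κ' → ∀ (a : ℕ → Quotient F) (b : ℕ → β → N),
    IsIndiscernible L A a b → ∀ i j : ℕ, i ≠ j →
      SameType L A (fun _ : Unit => a i) (fun _ => a j) (fun _ => b j) (fun _ => b i)

/-- The equivalence relations on `X` which are relatively type-definable over a subset of `M` of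
size less than `κ`, and have stable quotient (everything being hyperdefinable over `M`).
The order on `Setoid X` is inclusion, so finer relations are smaller. -/
def stableRelations (κ κ' : Cardinal.{u}) (M : L.ElementarySubstructure N) (X : Set N) :
    Set (Setoid X) :=
  {F | (∃ B : Set N, B ⊆ (M : Set N) ∧ #B < κ ∧ IsRelTypeDefOver L B F) ∧
    IsStableQuotient L κ' (M : Set N) F}

end General

/-! ## The reals with addition and local order -/

/-- The function symbols `+, -, 1`. -/
inductive LocFunc : ℕ → Type
  | add : LocFunc 2
  | neg : LocFunc 1
  | one : LocFunc 0

/-- The relation symbols `R_r`, for positive rational `r`. -/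
inductive LocRel : ℕ → Type
  | R (r : {q : ℚ // 0 < q}) : LocRel 2

/-- The language `{+, -, 1, R_r : r ∈ ℚ⁺}`. -/
def Lloc : FirstOrder.Language.{0, 0} := ⟨LocFunc, LocRel⟩

abbrev addSymb : Lloc.Functions 2 := LocFunc.add
abbrev negSymb : Lloc.Functions 1 := LocFunc.neg
abbrev oneSymb : Lloc.Functions 0 := LocFunc.one
abbrev RSymb (r : {q : ℚ // 0 < q}) : Lloc.Relations 2 := LocRel.R r

/-- The standard structure on `ℝ`: `R_r(x, y)` holds iff `0 ≤ y - x ≤ r`. -/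
instance realStructure : Lloc.Structure ℝ where
  funMap := fun {_} f =>
    match f with
    | LocFunc.add => fun v => v 0 + v 1
    | LocFunc.neg => fun v => - v 0
    | LocFunc.one => fun _ => 1
  RelMap := fun {_} R =>
    match R with
    | LocRel.R r => fun v => 0 ≤ v 1 - v 0 ∧ v 1 - v 0 ≤ ((r : ℚ) : ℝ)

/-- The complete theory of `(ℝ, +, -, 1, R_r)_{r ∈ ℚ⁺}`. -/
abbrev Tloc : Lloc.Theory := Lloc.completeTheory ℝ

section Operations

variable {N : Type u} [Lloc.Structure N]

def add (x y : N) : N := Structure.funMap addSymb ![x, y]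

def neg (x : N) : N := Structure.funMap negSymb ![x]

variable (N) in
def one : N := Structure.funMap oneSymb ![]

variable (N) in
/-- The neutral element `0 = 1 + (-1)`. -/
def zero : N := add (one N) (neg (one N))

/-- The multiple `n x = 0 + x + ⋯ + x`. -/
def nmul : ℕ → N → N
  | 0, _ => zero N
  | n + 1, x => add (nmul n x) x

def R (r : {q : ℚ // 0 < q}) (x y : N) : Prop := Structure.RelMap (RSymb r) ![x, y]

/-- `S_r(x, y)`: `R_r(x, y)` or `R_r(y, x)`. -/
def S (r : {q : ℚ // 0 < q}) (x y : N) : Prop := R r x y ∨ R r y x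

/-- `a` is a positive infinitesimal. -/
def IsPosInfinitesimal (a : N) : Prop := a ≠ zero N ∧ ∀ r, R r (zero N) a

/-- The relation `|x - y| ≤ a / n` for all `a ∈ A` and `n ≥ 1`; for positive infinitesimal `a`,
the inequality `z ≤ a` between `a` and an infinitesimal `z` is expressed by `R_1(z, a)`. -/
def relA (A : Set N) (x y : N) : Prop :=
  ∀ a ∈ A, ∀ n : ℕ, 1 ≤ n →
    R ⟨1, one_pos⟩ (nmul n (add x (neg y))) a ∧ R ⟨1, one_pos⟩ (nmul n (add y (neg x))) a

end Operations

section Transfer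

def tadd {α : Type} (s t : Lloc.Term α) : Lloc.Term α := addSymb.apply₂ s t
def tneg {α : Type} (s : Lloc.Term α) : Lloc.Term α := negSymb.apply₁ s
def tone {α : Type} : Lloc.Term α := Constants.term oneSymb
def tzero {α : Type} : Lloc.Term α := tadd tone (tneg tone)
def tnmul {α : Type} : ℕ → Lloc.Term α → Lloc.Term α
  | 0, _ => tzero
  | n + 1, t => tadd (tnmul n t) t

variable {N : Type u} [Lloc.Structure N]

lemma realize_tadd {α : Type} (s t : Lloc.Term α) (v : α → N) :
    (tadd s t).realize v = add (s.realize v) (t.realize v) :=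
  Term.realize_functions_apply₂

lemma realize_tneg {α : Type} (s : Lloc.Term α) (v : α → N) :
    (tneg s).realize v = neg (s.realize v) :=
  Term.realize_functions_apply₁

lemma realize_tone {α : Type} (v : α → N) : (tone : Lloc.Term α).realize v = one N := by
  unfold tone one
  rw [Term.realize_constants, constantMap]
  exact congrArg (Structure.funMap oneSymb) (Subsingleton.elim _ _)

lemma realize_tzero {α : Type} (v : α → N) : (tzero : Lloc.Term α).realize v = zero N := by
  simp only [tzero, zero, realize_tadd, realize_tneg, realize_tone]

lemma realize_tnmul {α : Type} (n : ℕ) (t : Lloc.Term α) (v : α → N) :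
    (tnmul n t).realize v = nmul n (t.realize v) := by
  induction n with
  | zero => exact realize_tzero v
  | succ n ih => simp only [tnmul, nmul, realize_tadd, ih]

lemma realize_R {n : ℕ} (r : {q : ℚ // 0 < q}) (s t : Lloc.Term (Empty ⊕ Fin n))
    (v : Empty → N) (xs : Fin n → N) :
    ((RSymb r).boundedFormula₂ s t).Realize v xs ↔
      R r (s.realize (Sum.elim v xs)) (t.realize (Sum.elim v xs)) :=
  BoundedFormula.realize_rel₂

lemma real_add (x y : ℝ) : add x y = x + y := rfl
lemma real_neg (x : ℝ) : neg x = - x := rfl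
lemma real_zero : zero ℝ = 0 := add_neg_cancel (1 : ℝ)
lemma real_R (r : {q : ℚ // 0 < q}) (x y : ℝ) :
    R r x y ↔ 0 ≤ y - x ∧ y - x ≤ ((r : ℚ) : ℝ) := Iff.rfl
lemma real_nmul (n : ℕ) (x : ℝ) : nmul n x = n * x := by
  induction n with
  | zero => simp [nmul, real_zero]
  | succ n ih => simp only [nmul, real_add, ih]; push_cast; ring

lemma transfer [Nonempty N] [N ⊨ Tloc] {n : ℕ} (φ : Lloc.BoundedFormula Empty n)
    (h : ∀ xs : Fin n → ℝ, φ.Realize default xs) (xs : Fin n → N) : φ.Realize default xs := by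
  have h1 : φ.alls ∈ Tloc := by
    rw [mem_completeTheory]
    refine BoundedFormula.realize_alls.2 fun xs => ?_
    convert h xs
  convert BoundedFormula.realize_alls.1 (Theory.realize_sentence_of_mem (M := N) Tloc h1) xs

end Transfer

section Relations

variable {N : Type u} [Lloc.Structure N] [Nonempty N] [N ⊨ Tloc]

lemma R_refl (r : {q : ℚ // 0 < q}) (x : N) : R r x x := by
  have := transfer (N := N) (n := 1) ((RSymb r).boundedFormula₂ (&0) (&0))
    (fun xs => by
      rw [realize_R, real_R]
      simp [r.2.le]) ![x]
  rw [realize_R] at this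
  simpa using this

lemma S_trans (r : {q : ℚ // 0 < q}) (x y z : N)
    (h1 : S ⟨r / 2, half_pos r.2⟩ x y) (h2 : S ⟨r / 2, half_pos r.2⟩ y z) : S r x z := by
  have := transfer (N := N) (n := 3)
    (((RSymb ⟨r / 2, half_pos r.2⟩).boundedFormula₂ (&0) (&1) ⊔
        (RSymb ⟨r / 2, half_pos r.2⟩).boundedFormula₂ (&1) (&0)).imp
      (((RSymb ⟨r / 2, half_pos r.2⟩).boundedFormula₂ (&1) (&2) ⊔
        (RSymb ⟨r / 2, half_pos r.2⟩).boundedFormula₂ (&2) (&1)).imp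
      ((RSymb r).boundedFormula₂ (&0) (&2) ⊔ (RSymb r).boundedFormula₂ (&2) (&0))))
    (fun xs => by
      have hr : (0 : ℝ) < ((r : ℚ) : ℝ) := by exact_mod_cast r.2
      simp only [BoundedFormula.realize_imp, BoundedFormula.realize_sup, realize_R, real_R,
        Function.comp_apply, Term.realize_var, Sum.elim_inr]
      push_cast
      intro h1 h2
      rcases le_total (xs 0) (xs 2) with h | h
      · left
        rcases h1 with h1 | h1 <;> rcases h2 with h2 | h2 <;>
          exact ⟨by linarith, by linarith [h1.1, h1.2, h2.1, h2.2]⟩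
      · right
        rcases h1 with h1 | h1 <;> rcases h2 with h2 | h2 <;>
          exact ⟨by linarith, by linarith [h1.1, h1.2, h2.1, h2.2]⟩) ![x, y, z]
  simp only [BoundedFormula.realize_imp, BoundedFormula.realize_sup, realize_R,
        Function.comp_apply, Term.realize_var, Sum.elim_inr] at this
  exact this h1 h2

lemma R_nmul_self (n : ℕ) (x a : N) (ha : R ⟨1, one_pos⟩ (zero N) a) :
    R ⟨1, one_pos⟩ (nmul n (add x (neg x))) a := by
  have := transfer (N := N) (n := 2)
    (((RSymb ⟨1, one_pos⟩).boundedFormula₂ tzero (&1)).imp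
      ((RSymb ⟨1, one_pos⟩).boundedFormula₂ (tnmul n (tadd (&0) (tneg (&0)))) (&1)))
    (fun xs => by
      simp only [BoundedFormula.realize_imp, realize_R, realize_tzero, realize_tnmul, realize_tadd,
        realize_tneg, Function.comp_apply, Term.realize_var, Sum.elim_inr, real_R, real_nmul, real_add, real_neg,
        real_zero]
      intro h
      simpa using h) ![x, a]
  simp only [BoundedFormula.realize_imp, realize_R, realize_tzero, realize_tnmul, realize_tadd,
        realize_tneg, Function.comp_apply, Term.realize_var, Sum.elim_inr] at this
  exact this ha

lemma R_nmul_trans (n : ℕ) (x y z a : N)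
    (h1 : R ⟨1, one_pos⟩ (nmul (2 * n) (add x (neg y))) a)
    (h2 : R ⟨1, one_pos⟩ (nmul (2 * n) (add y (neg z))) a) :
    R ⟨1, one_pos⟩ (nmul n (add x (neg z))) a := by
  have := transfer (N := N) (n := 4)
    (((RSymb ⟨1, one_pos⟩).boundedFormula₂ (tnmul (2 * n) (tadd (&0) (tneg (&1)))) (&3)).imp
      (((RSymb ⟨1, one_pos⟩).boundedFormula₂ (tnmul (2 * n) (tadd (&1) (tneg (&2)))) (&3)).imp
      ((RSymb ⟨1, one_pos⟩).boundedFormula₂ (tnmul n (tadd (&0) (tneg (&2)))) (&3))))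
    (fun xs => by
      simp only [BoundedFormula.realize_imp, realize_R, realize_tnmul, realize_tadd,
        realize_tneg, Function.comp_apply, Term.realize_var, Sum.elim_inr, real_R, real_nmul, real_add, real_neg]
      push_cast
      intro h1 h2
      constructor <;> linarith [h1.1, h1.2, h2.1, h2.2]) ![x, y, z, a]
  simp only [BoundedFormula.realize_imp, realize_R, realize_tnmul, realize_tadd,
        realize_tneg, Function.comp_apply, Term.realize_var, Sum.elim_inr] at this
  exact this h1 h2

variable (N) in
/-- Equality modulo infinitesimals: `S_r(x, y)` for all positive rational `r`. -/
def infSetoid : Setoid N where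
  r x y := ∀ r, S r x y
  iseqv :=
    { refl := fun x r => Or.inl (R_refl r x)
      symm := fun h r => (h r).symm
      trans := fun h1 h2 r => S_trans r _ _ _ (h1 _) (h2 _) }

/-- For a set `A` of positive infinitesimals, the equivalence relation `E_A`: `|x - y| ≤ a / n` for
all `a ∈ A` and `n ≥ 1`. -/
def setoidA (A : Set N) (hA : ∀ a ∈ A, IsPosInfinitesimal a) : Setoid N where
  r := relA A
  iseqv :=
    { refl := fun x a ha n _ =>
        ⟨R_nmul_self n x a ((hA a ha).2 _), R_nmul_self n x a ((hA a ha).2 _)⟩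
      symm := fun h a ha n hn => (h a ha n hn).symm
      trans := fun h1 h2 a ha n hn =>
        ⟨R_nmul_trans n _ _ _ a (h1 a ha (2 * n) (by omega)).1 (h2 a ha (2 * n) (by omega)).1,
         R_nmul_trans n _ _ _ a (h2 a ha (2 * n) (by omega)).2 (h1 a ha (2 * n) (by omega)).2⟩ }

/-- The partial type `{¬R_r(x, c) ∧ ¬R_r(c, x) : c ∈ A, r ∈ ℚ⁺}` over `A`. -/
def unrelatedType (A : Set N) : Set (Lloc[[A]].Formula Unit) :=
  {φ | ∃ (c : A) (r : {q : ℚ // 0 < q}),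
    φ = ∼(Relations.formula₂ ((Lloc.lhomWithConstants A).onRelation (RSymb r))
          (Term.var ()) (Lloc.con c).term) ⊓
        ∼(Relations.formula₂ ((Lloc.lhomWithConstants A).onRelation (RSymb r))
          (Lloc.con c).term (Term.var ()))}

end Relations

end HyperStable

/-! A model of `Tloc` is a `ℚ`-vector space with a partial order: `x ≤ y` when `R r x y` for some
`r`. Two elements are comparable exactly when they lie at bounded distance, and each class of
mutually comparable elements is a dense chain in which `1` is a local order unit. Since `R r` is
recovered from the order and `1` (`loc_R_iff`), a back-and-forth argument shows that in a saturated
model an order isomorphism between small subspaces fixing `1` is elementary (`realize_comp_iff`), so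
in the monster it extends to an automorphism. Two families of types over a small subspace `D`
containing `1` are then complete: elements incomparable to all of `D` (`IsFar`), and infinitesimals
above every infinitesimal of `D` (`IsLargeInfinitesimal`). The realizations of `p` are precisely the
elements far from `M`.

Stability of `E`: let `(a_i, b_i)` be indiscernible and `x_i` represent `a_i`. If `x_i` is
comparable to some element of the span of `M` and `b_j`, then the images of `b_j` determine the
image of `x_i` modulo infinitesimals, and indiscernibility forces `a_i = a_j`. Otherwise `x_i` is
far from the span of `M, b_j` and `x_j` from that of `M, b_i`, and far elements are conjugate.

Minimality: let `F` be an invariant relation with stable quotient. For a realization `x` and a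
rapidly increasing sequence of infinitesimals `ε_k`, the points `x + ε_k` are indiscernible.
Stability applied to their classes paired with the points themselves yields an `F`-related pair
whose difference is a large infinitesimal over `M` (`exists_rel_of_isStableQuotient`). All such
pairs are conjugate over `M`, so all are in `F`; and any two `E`-related points are both related to
one common point beyond them. Finally `E_A` is invariant but does not contain `E`, since it
separates `x` from `x + a`; hence its quotient is not stable. -/

namespace HyperStable

/-! ### First-order facts transferred from `ℝ` -/

section Axioms

attribute [local simp] realize_tadd realize_tneg realize_tone realize_tzero realize_tnmul
  real_add real_neg real_zero real_nmul

lemma real_one : one ℝ = 1 := rfl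

lemma real_relMap (r : {q : ℚ // 0 < q}) (x y : ℝ) :
    Structure.RelMap (RSymb r) ![x, y] ↔ 0 ≤ y - x ∧ y - x ≤ ((r : ℚ) : ℝ) := Iff.rfl

attribute [local simp] real_one real_relMap

variable {N : Type u} [Lloc.Structure N] [Nonempty N] [N ⊨ Tloc]

lemma loc_add_assoc (x y z : N) : add (add x y) z = add x (add y z) := by
  simpa using transfer (N := N) (n := 3)
    (Term.bdEqual (tadd (tadd (&0) (&1)) (&2)) (tadd (&0) (tadd (&1) (&2))))
    (fun xs => by simp [add_assoc]) ![x, y, z]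

lemma loc_add_comm (x y : N) : add x y = add y x := by
  simpa using transfer (N := N) (n := 2)
    (Term.bdEqual (tadd (&0) (&1)) (tadd (&1) (&0)))
    (fun xs => by simp [add_comm]) ![x, y]

lemma loc_zero_add (x : N) : add (zero N) x = x := by
  simpa using transfer (N := N) (n := 1)
    (Term.bdEqual (tadd tzero (&0)) (&0)) (fun xs => by simp) ![x]

lemma loc_neg_add_cancel (x : N) : add (neg x) x = zero N := by
  simpa using transfer (N := N) (n := 1)
    (Term.bdEqual (tadd (tneg (&0)) (&0)) tzero) (fun xs => by simp) ![x]

lemma loc_exists_nmul_eq {n : ℕ} (hn : n ≠ 0) (x : N) : ∃ y, nmul n y = x := by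
  simpa [Fin.snoc] using transfer (N := N) (n := 1)
    (BoundedFormula.ex (Term.bdEqual (tnmul n (&1)) (&0)))
    (fun xs => by
      have hn' : (n : ℝ) ≠ 0 := by exact_mod_cast hn
      simp only [BoundedFormula.realize_ex, BoundedFormula.realize_bdEqual]
      refine ⟨xs 0 / n, ?_⟩
      simp [Fin.snoc]
      field_simp) ![x]

lemma loc_nmul_eq_zero {n : ℕ} (hn : n ≠ 0) {x : N} (h : nmul n x = zero N) : x = zero N := by
  have := transfer (N := N) (n := 1)
    ((Term.bdEqual (tnmul n (&0)) tzero).imp (Term.bdEqual (&0) tzero))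
    (fun xs => by simp [hn]) ![x]
  simp at this
  exact this h

lemma loc_R_trans {r s : {q : ℚ // 0 < q}} {x y z : N} (h1 : R r x y) (h2 : R s y z) :
    R ⟨r + s, add_pos r.2 s.2⟩ x z := by
  have := transfer (N := N) (n := 3)
    (((RSymb r).boundedFormula₂ (&0) (&1)).imp
      (((RSymb s).boundedFormula₂ (&1) (&2)).imp
      ((RSymb ⟨r + s, add_pos r.2 s.2⟩).boundedFormula₂ (&0) (&2))))
    (fun xs => by
      simp
      intros
      constructor <;> linarith) ![x, y, z]
  simp at this
  exact this h1 h2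

lemma loc_R_antisymm {r s : {q : ℚ // 0 < q}} {x y : N} (h1 : R r x y) (h2 : R s y x) :
    x = y := by
  have := transfer (N := N) (n := 2)
    (((RSymb r).boundedFormula₂ (&0) (&1)).imp
      (((RSymb s).boundedFormula₂ (&1) (&0)).imp (Term.bdEqual (&0) (&1))))
    (fun xs => by
      simp
      intros
      linarith) ![x, y]
  simp at this
  exact this h1 h2

lemma loc_R_add {r : {q : ℚ // 0 < q}} {x y : N} (h : R r x y) (z : N) :
    R r (add x z) (add y z) := by
  have := transfer (N := N) (n := 3)
    (((RSymb r).boundedFormula₂ (&0) (&1)).imp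
      ((RSymb r).boundedFormula₂ (tadd (&0) (&2)) (tadd (&1) (&2))))
    (fun xs => by simp) ![x, y, z]
  simp at this
  exact this h

lemma loc_R_total {r s : {q : ℚ // 0 < q}} {x y z : N} (h1 : R r x y) (h2 : R s x z) :
    R ⟨r + s, add_pos r.2 s.2⟩ y z ∨ R ⟨r + s, add_pos r.2 s.2⟩ z y := by
  have := transfer (N := N) (n := 3)
    (((RSymb r).boundedFormula₂ (&0) (&1)).imp
      (((RSymb s).boundedFormula₂ (&0) (&2)).imp
      ((RSymb ⟨r + s, add_pos r.2 s.2⟩).boundedFormula₂ (&1) (&2) ⊔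
        (RSymb ⟨r + s, add_pos r.2 s.2⟩).boundedFormula₂ (&2) (&1))))
    (fun xs => by
      have hr : (0 : ℝ) < ((r : ℚ) : ℝ) := by exact_mod_cast r.2
      have hs : (0 : ℝ) < ((s : ℚ) : ℝ) := by exact_mod_cast s.2
      simp
      intros
      rcases le_total (xs 1) (xs 2) with h | h
      · left; constructor <;> linarith
      · right; constructor <;> linarith) ![x, y, z]
  simp at this
  exact this h1 h2

lemma loc_R_zero_one : R ⟨1, one_pos⟩ (zero N) (one N) := by
  have := transfer (N := N) (n := 0) ((RSymb ⟨1, one_pos⟩).boundedFormula₂ tzero tone)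
    (fun xs => by simp) ![]
  simp at this
  exact this

lemma loc_one_ne_zero : one N ≠ zero N := by
  simpa using transfer (N := N) (n := 0) (∼(Term.bdEqual tone tzero)) (fun xs => by simp) ![]

lemma loc_R_of_nmul {n : ℕ} (hn : n ≠ 0) {r : {q : ℚ // 0 < q}} {x : N}
    (h : R r (zero N) (nmul n x)) : R r (zero N) x := by
  have := transfer (N := N) (n := 1)
    (((RSymb r).boundedFormula₂ tzero (tnmul n (&0))).imp ((RSymb r).boundedFormula₂ tzero (&0)))
    (fun xs => by
      have hn' : (1 : ℝ) ≤ n := by exact_mod_cast Nat.one_le_iff_ne_zero.2 hn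
      simp
      intro h1 h2
      have h3 : 0 ≤ xs 0 := by
        by_contra! h
        nlinarith
      exact ⟨h3, by nlinarith⟩) ![x]
  simp at this
  exact this h

/-- The rational bound `r = m / n` is not a term of the language, so it is expressed after clearing
the denominator. The converse `loc_R_of_nmul_le` also assumes a cruder bound `s`, which makes the
order between `x` and `y` visible. -/
lemma loc_R_nmul {n m : ℕ} {r s : {q : ℚ // 0 < q}} (hr : (r : ℚ) * n = m) (hs : (s : ℚ) = m)
    {x y : N} (h : R r x y) :
    R s (nmul n y) (add (nmul n x) (nmul m (one N))) := by
  have := transfer (N := N) (n := 2)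
    (((RSymb r).boundedFormula₂ (&0) (&1)).imp
      ((RSymb s).boundedFormula₂ (tnmul n (&1)) (tadd (tnmul n (&0)) (tnmul m tone))))
    (fun xs => by
      have hr' : ((r : ℚ) : ℝ) * n = m := by exact_mod_cast hr
      have hs' : ((s : ℚ) : ℝ) = m := by exact_mod_cast hs
      have hn : (0 : ℝ) ≤ n := by positivity
      simp
      intro h1 h2
      constructor <;> nlinarith) ![x, y]
  simp at this
  exact this h

lemma loc_R_of_nmul_le {n m : ℕ} (hn : n ≠ 0) {r s t : {q : ℚ // 0 < q}} (hr : (r : ℚ) * n = m)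
    {x y : N} (h : R s x y) (h' : R t (nmul n y) (add (nmul n x) (nmul m (one N)))) :
    R r x y := by
  have := transfer (N := N) (n := 2)
    (((RSymb s).boundedFormula₂ (&0) (&1)).imp
      (((RSymb t).boundedFormula₂ (tnmul n (&1)) (tadd (tnmul n (&0)) (tnmul m tone))).imp
        ((RSymb r).boundedFormula₂ (&0) (&1))))
    (fun xs => by
      have hr' : ((r : ℚ) : ℝ) * n = m := by exact_mod_cast hr
      have hn' : (0 : ℝ) < n := by positivity
      simp
      intro h1 h2 h3 h4
      refine ⟨h1, ?_⟩
      rw [← hr'] at h3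
      have : (n : ℝ) * xs 1 ≤ n * (xs 0 + r) := by linarith
      linarith [le_of_mul_le_mul_left this hn']) ![x, y]
  simp at this
  exact this h h'

end Axioms

/-! ### The ordered rational vector space underlying a model -/

section OrderedModule

variable {N : Type u} [Lloc.Structure N] [Nonempty N] [N ⊨ Tloc]

variable (N) in
/-- The additive group underlying a model of `Tloc`. -/
@[reducible] def locAddCommGroup : AddCommGroup N where
  add := add
  zero := zero N
  neg := neg
  nsmul := nmul
  nsmul_zero _ := rfl
  nsmul_succ _ _ := rfl
  zsmul := @zsmulRec N ⟨zero N⟩ ⟨add⟩ ⟨neg⟩ nmul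
  add_assoc := loc_add_assoc
  zero_add := loc_zero_add
  add_zero x := (loc_add_comm _ _).trans (loc_zero_add x)
  neg_add_cancel := loc_neg_add_cancel
  add_comm := loc_add_comm

attribute [local instance] locAddCommGroup

lemma loc_isAddTorsionFree : IsAddTorsionFree N where
  nsmul_right_injective n hn x y h := by
    have h' : n • x = n • y := h
    rw [← sub_eq_zero] at h' ⊢
    rw [← smul_sub] at h'
    exact loc_nmul_eq_zero hn h'

lemma loc_exists_rat_smul (q : ℚ) (x : N) : ∃ y : N, q.den • y = q.num • x :=
  loc_exists_nmul_eq q.den_nz _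

/-- Multiplication by rational numbers in a model of `Tloc`. -/
noncomputable def ratSMul (q : ℚ) (x : N) : N := (loc_exists_rat_smul q x).choose

lemma den_ratSMul (q : ℚ) (x : N) : q.den • ratSMul q x = q.num • x :=
  (loc_exists_rat_smul q x).choose_spec

/-- Torsion-freeness allows any fraction `n / d` representing `q`, not only the reduced one, so the
module axioms can be checked over a common denominator. -/
lemma ratSMul_eq_iff {q : ℚ} {d n : ℤ} (hd : d ≠ 0) (hq : q * d = n) {x y : N} :
    ratSMul q x = y ↔ n • x = d • y := by
  have := loc_isAddTorsionFree (N := N)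
  have hq0 : (q.den : ℤ) ≠ 0 := by exact_mod_cast q.den_nz
  have h1 : q.num * d = n * q.den := by
    have : (q.num : ℚ) = q * q.den := (Rat.mul_den_eq_num q).symm
    have h2 : (q.num : ℚ) * d = n * q.den := by rw [this, ← hq]; ring
    exact_mod_cast h2
  have h2 : (q.den : ℤ) • ratSMul q x = q.num • x := by
    rw [natCast_zsmul]; exact den_ratSMul q x
  have h3 : (q.den : ℤ) • (d • ratSMul q x) = (q.den : ℤ) • (n • x) := by
    rw [smul_comm, h2, smul_smul, smul_smul, mul_comm d, h1, mul_comm n]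
  have h4 : d • ratSMul q x = n • x := zsmul_right_injective hq0 h3
  rw [← h4]
  exact ⟨fun h => by rw [h], fun h => zsmul_right_injective hd h⟩

variable (N) in
/-- A model of `Tloc` is a vector space over `ℚ`. -/
@[reducible] noncomputable def locModule : Module ℚ N where
  smul := ratSMul
  one_smul x := (ratSMul_eq_iff (d := 1) (n := 1) one_ne_zero (by simp)).2 rfl
  zero_smul x := (ratSMul_eq_iff (d := 1) (n := 0) one_ne_zero (by simp)).2 (by simp)
  smul_zero q := (ratSMul_eq_iff (d := q.den) (n := q.num) (by simp) (by simp)).2 (by simp)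
  smul_add q x y := (ratSMul_eq_iff (d := q.den) (n := q.num) (by simp) (by simp)).2 (by
    have h1 := den_ratSMul q x
    have h2 := den_ratSMul q y
    change _ = _ • (ratSMul q x + ratSMul q y)
    rw [smul_add, smul_add, natCast_zsmul, natCast_zsmul, h1, h2])
  mul_smul q r x := (ratSMul_eq_iff (d := q.den * r.den) (n := q.num * r.num) (by simp)
    (by push_cast
        calc q * r * (q.den * r.den) = (q * q.den) * (r * r.den) := by ring
          _ = _ := by rw [Rat.mul_den_eq_num, Rat.mul_den_eq_num])).2 (by
    have h1 : (q.den : ℤ) • ratSMul q (ratSMul r x) = q.num • ratSMul r x := by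
      rw [natCast_zsmul]; exact den_ratSMul q _
    have h2 : (r.den : ℤ) • ratSMul r x = r.num • x := by
      rw [natCast_zsmul]; exact den_ratSMul r x
    change _ = _ • ratSMul q (ratSMul r x)
    rw [mul_comm (q.den : ℤ), mul_smul (r.den : ℤ), h1, smul_comm (r.den : ℤ), h2, mul_smul])
  add_smul q r x := (ratSMul_eq_iff (d := q.den * r.den) (n := q.num * r.den + r.num * q.den)
    (by simp)
    (by push_cast
        calc (q + r) * (q.den * r.den) = (q * q.den) * r.den + (r * r.den) * q.den := by ring
          _ = _ := by rw [Rat.mul_den_eq_num, Rat.mul_den_eq_num])).2 (by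
    have h1 : (q.den : ℤ) • ratSMul q x = q.num • x := by
      rw [natCast_zsmul]; exact den_ratSMul q x
    have h2 : (r.den : ℤ) • ratSMul r x = r.num • x := by
      rw [natCast_zsmul]; exact den_ratSMul r x
    change _ = _ • (ratSMul q x + ratSMul r x)
    rw [smul_add, add_smul, mul_comm q.num, mul_smul, ← h1, mul_comm r.num, mul_smul, ← h2,
      smul_smul, smul_smul, mul_comm (r.den : ℤ)])

attribute [local instance] locModule

variable (N) in
/-- The local order of a model of `Tloc`: `x ≤ y` iff `y - x` is non-negative and bounded. -/
@[reducible] def locPartialOrder : PartialOrder N where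
  le x y := ∃ r, R r x y
  le_refl x := ⟨⟨1, one_pos⟩, R_refl _ x⟩
  le_trans _ _ _ := fun ⟨_, h1⟩ ⟨_, h2⟩ => ⟨_, loc_R_trans h1 h2⟩
  le_antisymm _ _ := fun ⟨_, h1⟩ ⟨_, h2⟩ => loc_R_antisymm h1 h2

attribute [local instance] locPartialOrder

lemma loc_isOrderedAddMonoid : IsOrderedAddMonoid N where
  add_le_add_left _ _ := fun ⟨r, h⟩ z => ⟨r, loc_R_add h z⟩

attribute [local instance] loc_isOrderedAddMonoid

lemma loc_nonneg_of_nsmul {n : ℕ} (hn : n ≠ 0) {x : N} (h : 0 ≤ n • x) : 0 ≤ x :=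
  h.imp fun _ => loc_R_of_nmul hn

lemma loc_isStrictOrderedModule : IsStrictOrderedModule ℚ N := by
  have key : ∀ q : ℚ, 0 ≤ q → ∀ x : N, 0 ≤ x → 0 ≤ q • x := fun q hq x hx => by
    apply loc_nonneg_of_nsmul q.den_nz
    have h1 : q.den • (q • x) = q.num • x := den_ratSMul q x
    obtain ⟨n, hn⟩ := Int.eq_ofNat_of_zero_le (Rat.num_nonneg.2 hq)
    rw [h1, hn, natCast_zsmul]
    exact nsmul_nonneg hx n
  have : IsOrderedModule ℚ N := IsOrderedModule.of_smul_nonneg key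
  exact { PosSMulMono.toPosSMulStrictMono (α := ℚ) (β := N),
    SMulPosMono.toSMulPosStrictMono (α := ℚ) (β := N) with }

attribute [local instance] loc_isStrictOrderedModule

lemma loc_zero_le_one : (0 : N) ≤ one N := ⟨_, loc_R_zero_one⟩

lemma loc_zero_lt_one : (0 : N) < one N :=
  lt_of_le_of_ne loc_zero_le_one loc_one_ne_zero.symm

/-- Elements with a common lower bound are comparable. -/
lemma loc_total_of_le {x y z : N} (h1 : x ≤ y) (h2 : x ≤ z) : y ≤ z ∨ z ≤ y := by
  obtain ⟨r, h1⟩ := h1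
  obtain ⟨s, h2⟩ := h2
  exact (loc_R_total h1 h2).imp (fun h => ⟨_, h⟩) (fun h => ⟨_, h⟩)

/-- Order and `1` determine every relation symbol; order-preserving linear maps fixing `1` therefore
respect atomic formulas. -/
lemma loc_R_iff {r : {q : ℚ // 0 < q}} {x y : N} :
    R r x y ↔ x ≤ y ∧ y ≤ x + (r : ℚ) • one N := by
  obtain ⟨r, hr⟩ := r
  obtain ⟨m, hm⟩ := Int.eq_ofNat_of_zero_le (Rat.num_pos.2 hr).le
  have hm' : r * r.den = m := by rw [Rat.mul_den_eq_num, hm]; rfl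
  have hm0 : (0 : ℚ) < m := by rw [← hm']; positivity
  have e : (m : ℕ) • one N = r.den • (r • one N) := by
    rw [← Nat.cast_smul_eq_nsmul ℚ, ← Nat.cast_smul_eq_nsmul ℚ, smul_smul, mul_comm, hm']
  constructor
  · intro h
    refine ⟨⟨_, h⟩, ?_⟩
    have h1 : r.den • y ≤ r.den • x + m • one N :=
      ⟨⟨m, hm0⟩, loc_R_nmul (r := ⟨r, hr⟩) hm' rfl h⟩
    rw [e, ← smul_add, ← sub_nonneg, ← smul_sub] at h1
    exact sub_nonneg.1 (loc_nonneg_of_nsmul r.den_nz h1)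
  · rintro ⟨⟨s, h1⟩, h2⟩
    have h3 : r.den • y ≤ r.den • x + m • one N := by
      rw [e, ← smul_add]
      exact nsmul_le_nsmul_right h2 _
    obtain ⟨t, h3⟩ := h3
    exact loc_R_of_nmul_le r.den_nz (r := ⟨r, hr⟩) hm' h1 h3

/-- The element `1` is a local order unit. -/
lemma loc_exists_le {x y : N} (h : x ≤ y) : ∃ r : ℚ, 0 < r ∧ y ≤ x + r • one N :=
  h.elim fun r h => ⟨r, r.2, (loc_R_iff.1 h).2⟩

/-- Elements with a common upper bound are comparable. -/
lemma loc_total_of_ge {x y z : N} (h1 : y ≤ x) (h2 : z ≤ x) : y ≤ z ∨ z ≤ y := by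
  have := loc_total_of_le (neg_le_neg h1) (neg_le_neg h2)
  simpa [or_comm] using this

lemma loc_S_iff {r : {q : ℚ // 0 < q}} {x y : N} :
    S r x y ↔ y ≤ x + (r : ℚ) • one N ∧ x ≤ y + (r : ℚ) • one N := by
  have hr : (0 : N) ≤ (r : ℚ) • one N := smul_nonneg r.2.le loc_zero_le_one
  simp only [S, loc_R_iff]
  constructor
  · rintro (h | h)
    · exact ⟨h.2, h.1.trans (le_add_of_nonneg_right hr)⟩
    · exact ⟨h.1.trans (le_add_of_nonneg_right hr), h.2⟩
  · rintro ⟨h1, h2⟩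
    have h3 : x ≤ x + (r : ℚ) • one N := le_add_of_nonneg_right hr
    exact (loc_total_of_ge h1 h3).symm.imp (fun h => ⟨h, h1⟩) (fun h => ⟨h, h2⟩)

lemma loc_lt_midpoint {x y : N} (h : x < y) :
    x < (2⁻¹ : ℚ) • (x + y) ∧ (2⁻¹ : ℚ) • (x + y) < y := by
  rw [lt_inv_smul_iff_of_pos two_pos, inv_smul_lt_iff_of_pos two_pos, two_smul, two_smul]
  exact ⟨add_lt_add_right h x, add_lt_add_left h y⟩

end OrderedModule

/-! ### Saturation and homogeneity in usable form -/

section Saturation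

variable {L : FirstOrder.Language.{0, 0}} {N : Type u} [L.Structure N] {κ : Cardinal.{u}}

/-- In a saturated structure, a family of sets definable over few parameters which has the finite
intersection property has a common point. -/
lemma IsSaturated.exists_forall_mem (hN : IsSaturated L κ N) {A : Set N} (hA : #A < κ)
    {ι : Type*} {P : ι → Set N} (hP : ∀ i, A.Definable₁ L (P i))
    (hfin : ∀ T : Finset ι, ∃ a, ∀ i ∈ T, a ∈ P i) : ∃ a, ∀ i, a ∈ P i := by
  classical
  have hφ : ∀ i, ∃ φ : L[[A]].Formula Unit, ∀ a, φ.Realize (fun _ => a) ↔ a ∈ P i := fun i => by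
    obtain ⟨φ, hφ⟩ := hP i
    refine ⟨φ.relabel (fun _ => ()), fun a => ?_⟩
    rw [Formula.realize_relabel]
    exact (Set.ext_iff.1 hφ (fun _ => a)).symm
  choose φ hφ using hφ
  obtain ⟨a, ha⟩ := hN A hA (Set.range φ) fun s hs => by
    choose idx hidx using hs
    obtain ⟨a, ha⟩ := hfin (s.attach.image fun ψ => idx ψ.2)
    refine ⟨a, fun ψ hψ => ?_⟩
    rw [← hidx hψ, hφ]
    exact ha _ (Finset.mem_image_of_mem _ (Finset.mem_attach _ ⟨ψ, hψ⟩))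
  exact ⟨a, fun i => (hφ i a).1 (ha _ ⟨i, rfl⟩)⟩

/-- In a strongly homogeneous structure, two short tuples with the same type are conjugate. -/
lemma IsStronglyHomogeneous.exists_equiv (hN : IsStronglyHomogeneous L κ N) {ι : Type u}
    (hι : #ι < κ) (v w : ι → N) (h : ∀ φ : L.Formula ι, φ.Realize v ↔ φ.Realize w) :
    ∃ σ : N ≃[L] N, ∀ i, σ (v i) = w i := by
  choose idx hidx using fun a : Set.range v => a.2
  obtain ⟨σ, hσ⟩ := hN (Set.range v) (mk_range_le.trans_lt hι) (fun a => w (idx a)) fun φ => by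
    have := h (φ.relabel idx)
    rw [Formula.realize_relabel, Formula.realize_relabel] at this
    rwa [show v ∘ idx = fun a : Set.range v => (a : N) from funext hidx] at this
  refine ⟨σ, fun i => ?_⟩
  -- The chosen index of `v i` may differ from `i`; equality is itself a formula, so `w` agrees at
  -- the two indices.
  have h1 := h (Term.equal (Term.var (idx ⟨v i, i, rfl⟩)) (Term.var i))
  simp only [Formula.realize_equal, Term.realize_var] at h1
  rw [← h1.1 (hidx _)]
  exact hσ ⟨v i, i, rfl⟩

end Saturation

/-! ### Definability of the basic sets -/

section Definable

variable {N : Type u} [Lloc.Structure N] {A : Set N}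

lemma definable_R_left {a : N} (ha : a ∈ A) (r : {q : ℚ // 0 < q}) :
    A.Definable₁ Lloc {z | R r a z} := by
  refine ⟨Relations.formula₂ ((Lloc.lhomWithConstants A).onRelation (RSymb r))
    (Lloc.con (⟨a, ha⟩ : A)).term (Term.var 0), ?_⟩
  ext x
  refine Iff.trans ?_ Formula.realize_rel₂.symm
  rw [LHom.map_onRelation, Term.realize_con, Term.realize_var]
  rfl

lemma definable_R_right {a : N} (ha : a ∈ A) (r : {q : ℚ // 0 < q}) :
    A.Definable₁ Lloc {z | R r z a} := by
  refine ⟨Relations.formula₂ ((Lloc.lhomWithConstants A).onRelation (RSymb r))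
    (Term.var 0) (Lloc.con (⟨a, ha⟩ : A)).term, ?_⟩
  ext x
  refine Iff.trans ?_ Formula.realize_rel₂.symm
  rw [LHom.map_onRelation, Term.realize_con, Term.realize_var]
  rfl

lemma definable_ne {a : N} (ha : a ∈ A) : A.Definable₁ Lloc {z | z ≠ a} :=
  Set.Definable.compl (s := {x : Fin 1 → N | x 0 = a}) (Set.Definable.singleton_of_mem Lloc ha)

end Definable

/-! ### Back-and-forth between small subspaces -/

section Extension

variable {N : Type u} [Lloc.Structure N] [Nonempty N] [N ⊨ Tloc]

attribute [local instance] locAddCommGroup locModule locPartialOrder loc_isOrderedAddMonoid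
  loc_isStrictOrderedModule

variable {V : Type u} [AddCommGroup V] [Module ℚ V] {f g : V →ₗ[ℚ] N} {e : V} {κ : Cardinal.{u}}

lemma map_le_map_iff (h : ∀ t, 0 ≤ f t ↔ 0 ≤ g t) (s t : V) : f s ≤ f t ↔ g s ≤ g t := by
  rw [← sub_nonneg, ← map_sub, h, map_sub, sub_nonneg]

lemma map_eq_map_iff (h : ∀ t, 0 ≤ f t ↔ 0 ≤ g t) (s t : V) : f s = f t ↔ g s = g t := by
  rw [le_antisymm_iff, map_le_map_iff h, map_le_map_iff h, ← le_antisymm_iff]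

lemma map_add_smul_one (hf : f e = one N) (t : V) (r : ℚ) :
    f (t + r • e) = f t + r • one N := by rw [map_add, map_smul, hf]

/-- Two such multiples differ by at most `2r`. Hence natural multiples of `1` satisfy any finite
part of the type of an element far from a set. -/
lemma finite_setOf_S_nsmul_one (x : N) (r : {q : ℚ // 0 < q}) :
    {n : ℕ | S r x ((n : ℚ) • one N)}.Finite := by
  rcases Set.eq_empty_or_nonempty {n : ℕ | S r x ((n : ℚ) • one N)} with h | ⟨m, hm⟩
  · rw [h]; exact Set.finite_empty
  · obtain ⟨k, hk⟩ := exists_nat_ge ((m : ℚ) + 2 * r)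
    refine (Set.finite_le_nat k).subset fun n hn => ?_
    have h1 := (loc_S_iff.1 hn).1
    have h2 := (loc_S_iff.1 hm).2
    have h3 : (n : ℚ) • one N ≤ ((m : ℚ) + 2 * r) • one N := by
      refine h1.trans ((add_le_add_left h2 _).trans_eq ?_)
      module
    have h4 : (n : ℚ) ≤ k := ((smul_le_smul_iff_of_pos_right loc_zero_lt_one).1 h3).trans hk
    exact_mod_cast h4

/-- A saturated model contains elements far from any small set. -/
lemma exists_forall_not_S (hN : IsSaturated Lloc κ N) {A : Set N} (hA : #A < κ) :
    ∃ c : N, ∀ a ∈ A, ∀ r, ¬ S r a c := by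
  obtain ⟨c, hc⟩ := hN.exists_forall_mem hA (ι := A × {q : ℚ // 0 < q})
    (P := fun p => {z | ¬ S p.2 (p.1 : N) z})
    (fun p => Set.Definable.compl (Set.Definable.union (definable_R_left p.1.2 p.2)
      (definable_R_right p.1.2 p.2))) (fun T => by
      have h1 : (⋃ p ∈ T, {n : ℕ | S p.2 (p.1 : N) ((n : ℚ) • one N)}).Finite :=
        T.finite_toSet.biUnion fun p _ => finite_setOf_S_nsmul_one _ _
      obtain ⟨n, hn⟩ := h1.exists_notMem
      simp only [Set.mem_iUnion, not_exists] at hn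
      exact ⟨(n : ℚ) • one N, fun p hp => hn p hp⟩)
  exact ⟨c, fun a ha r => hc (⟨a, ha⟩, r)⟩

/-- A saturated model fills every cut over a small vector space. -/
lemma exists_same_cut_of_le (hN : IsSaturated Lloc κ N) (hV : #V < κ)
    (hf : f e = one N) (h : ∀ t, 0 ≤ f t ↔ 0 ≤ g t) {b : N}
    (hb : ∀ t, f t ≠ b) {t₀ : V} (ht₀ : f t₀ ≤ b) :
    ∃ c, (∀ t, f t ≤ b ↔ g t ≤ c) ∧ ∀ t, b ≤ f t ↔ c ≤ g t := by
  have hle := map_le_map_iff h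
  obtain ⟨t₁, ht₁⟩ : ∃ t₁, b ≤ f t₁ := by
    obtain ⟨r, -, hr⟩ := loc_exists_le ht₀
    exact ⟨t₀ + r • e, by rwa [map_add_smul_one hf]⟩
  obtain ⟨c, hc⟩ := hN.exists_forall_mem (A := Set.range g) (mk_range_le.trans_lt hV)
    (ι := {p : V × V // f p.1 ≤ b ∧ b ≤ f p.2}) (P := fun p => {z | g p.1.1 < z ∧ z < g p.1.2})
    (fun p => by
      -- The order is only a union of definable relations, but inside a bounded interval a single `R
      -- r` defines it.
      obtain ⟨r, hr, hr'⟩ := loc_exists_le ((hle _ _).1 (p.2.1.trans p.2.2))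
      have : {z | g p.1.1 < z ∧ z < g p.1.2} = {z | R ⟨r, hr⟩ (g p.1.1) z ∧ z ≠ g p.1.1} ∩
          {z | R ⟨r, hr⟩ z (g p.1.2) ∧ z ≠ g p.1.2} := by
        ext z
        simp only [Set.mem_ofPred_eq, Set.mem_inter_iff, loc_R_iff]
        constructor
        · rintro ⟨h1, h2⟩
          exact ⟨⟨⟨h1.le, h2.le.trans hr'⟩, h1.ne'⟩, ⟨h2.le, hr'.trans (add_le_add_left h1.le _)⟩,
            h2.ne⟩
        · rintro ⟨⟨⟨h1, -⟩, h2⟩, ⟨h3, -⟩, h4⟩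
          exact ⟨lt_of_le_of_ne h1 h2.symm, lt_of_le_of_ne h3 h4⟩
      rw [this]
      exact Set.Definable.inter (Set.Definable.inter (definable_R_left (Set.mem_range_self _) _)
        (definable_ne (Set.mem_range_self _)))
        (Set.Definable.inter (definable_R_right (Set.mem_range_self _) _)
        (definable_ne (Set.mem_range_self _))))
    (fun T => by
      classical
      -- Finitely many intervals around the cut have a common subinterval: lower bounds share the
      -- upper bound `b` and upper bounds the lower bound `b`, so each family is a chain. Its
      -- midpoint is the witness.
      obtain ⟨l, m, hl, hm, hlm⟩ : ∃ l m, f l ≤ b ∧ b ≤ f m ∧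
          ∀ p ∈ T, g p.1.1 ≤ g l ∧ g m ≤ g p.1.2 := by
        induction T using Finset.induction_on with
        | empty => exact ⟨t₀, t₁, ht₀, ht₁, by simp⟩
        | insert p T _ ih =>
          obtain ⟨l, m, hl, hm, hlm⟩ := ih
          obtain ⟨l', hl', h1, h2⟩ : ∃ l', f l' ≤ b ∧ g l ≤ g l' ∧ g p.1.1 ≤ g l' := by
            rcases loc_total_of_ge hl p.2.1 with h1 | h1
            · exact ⟨p.1.1, p.2.1, (hle _ _).1 h1, le_rfl⟩
            · exact ⟨l, hl, le_rfl, (hle _ _).1 h1⟩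
          obtain ⟨m', hm', h3, h4⟩ : ∃ m', b ≤ f m' ∧ g m' ≤ g m ∧ g m' ≤ g p.1.2 := by
            rcases loc_total_of_le hm p.2.2 with h1 | h1
            · exact ⟨m, hm, le_rfl, (hle _ _).1 h1⟩
            · exact ⟨p.1.2, p.2.2, (hle _ _).1 h1, le_rfl⟩
          refine ⟨l', m', hl', hm', fun q hq => ?_⟩
          rcases Finset.mem_insert.1 hq with rfl | hq
          · exact ⟨h2, h4⟩
          · exact ⟨(hlm q hq).1.trans h1, h3.trans (hlm q hq).2⟩
      have hlt : g l < g m := by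
        refine lt_of_le_of_ne ((hle _ _).1 (hl.trans hm)) fun h1 => hb l ?_
        exact le_antisymm hl (hm.trans_eq ((map_eq_map_iff h _ _).2 h1).symm)
      refine ⟨(2⁻¹ : ℚ) • (g l + g m), fun p hp => ⟨(hlm p hp).1.trans_lt
        (loc_lt_midpoint hlt).1, (loc_lt_midpoint hlt).2.trans_le (hlm p hp).2⟩⟩)
  have h1 : ∀ t, f t ≤ b → g t < c := fun t ht => (hc ⟨(t, t₁), ht, ht₁⟩).1
  have h2 : ∀ t, b ≤ f t → c < g t := fun t ht => (hc ⟨(t₀, t), ht₀, ht⟩).2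
  -- Comparability with `b` follows from comparability with `f t₀`, which turns the one-sided
  -- implications into equivalences.
  have h3 : ∀ t, f t₀ ≤ f t → f t ≤ b ∨ b ≤ f t := fun t ht => (loc_total_of_le ht ht₀)
  refine ⟨c, fun t => ⟨fun ht => (h1 t ht).le, fun ht => ?_⟩,
    fun t => ⟨fun ht => (h2 t ht).le, fun ht => ?_⟩⟩
  · rcases loc_total_of_ge ht (h1 _ ht₀).le with h4 | h4
    · exact ((hle _ _).2 h4).trans ht₀
    · exact (h3 t ((hle _ _).2 h4)).resolve_right fun h5 => (h2 t h5).not_ge ht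
  · exact (h3 t ((hle _ _).2 ((h1 _ ht₀).le.trans ht))).resolve_left
      fun h5 => (h1 t h5).not_ge ht

/-- There are three positions for `b`: in the range of `f`, in a proper cut at bounded distance from
the range, or incomparable to the whole range. -/
lemma exists_same_cut (hN : IsSaturated Lloc κ N) (hV : #V < κ)
    (hf : f e = one N) (h : ∀ t, 0 ≤ f t ↔ 0 ≤ g t) (b : N) :
    ∃ c, (∀ t, f t ≤ b ↔ g t ≤ c) ∧ ∀ t, b ≤ f t ↔ c ≤ g t := by
  by_cases hb : ∃ t, f t = b
  · obtain ⟨s, rfl⟩ := hb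
    exact ⟨g s, fun t => map_le_map_iff h _ _, fun t => map_le_map_iff h _ _⟩
  push Not at hb
  by_cases h0 : ∃ t₀, f t₀ ≤ b
  · exact exists_same_cut_of_le hN hV hf h hb h0.choose_spec
  push Not at h0
  have h1 : ∀ t, ¬ b ≤ f t := fun t ht => by
    obtain ⟨r, -, hr⟩ := loc_exists_le ht
    refine h0 (t + (-r) • e) ?_
    rwa [map_add_smul_one hf, neg_smul, ← sub_eq_add_neg, sub_le_iff_le_add]
  obtain ⟨c, hc⟩ := exists_forall_not_S hN (A := Set.range g) (mk_range_le.trans_lt hV)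
  refine ⟨c, fun t => iff_of_false (h0 t) ?_, fun t => iff_of_false (h1 t) ?_⟩
  · exact fun ⟨r, hr⟩ => hc _ ⟨t, rfl⟩ r (Or.inl hr)
  · exact fun ⟨r, hr⟩ => hc _ ⟨t, rfl⟩ r (Or.inr hr)

/-- The linear map `(t, q) ↦ f t + q b`. -/
noncomputable abbrev extendMap (f : V →ₗ[ℚ] N) (b : N) : V × ℚ →ₗ[ℚ] N :=
  f.coprod (LinearMap.toSpanSingleton ℚ N b)

/-- For `q ≠ 0` the condition `0 ≤ t + q b` compares `b` with `-t / q`, so it depends only on the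
cut of `b`. -/
lemma nonneg_extendMap_iff (h : ∀ t, 0 ≤ f t ↔ 0 ≤ g t) {b c : N}
    (h1 : ∀ t, f t ≤ b ↔ g t ≤ c) (h2 : ∀ t, b ≤ f t ↔ c ≤ g t) (p : V × ℚ) :
    0 ≤ extendMap f b p ↔ 0 ≤ extendMap g c p := by
  obtain ⟨t, q⟩ := p
  simp only [LinearMap.coprod_apply, LinearMap.toSpanSingleton_apply]
  rcases lt_trichotomy q 0 with hq | rfl | hq
  · have key : ∀ (k : V →ₗ[ℚ] N) (x : N), 0 ≤ k t + q • x ↔ x ≤ k ((-q)⁻¹ • t) := fun k x => by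
      rw [map_smul, le_inv_smul_iff_of_pos (neg_pos.2 hq), neg_smul, neg_le_iff_add_nonneg]
    rw [key, key, h2]
  · simpa using h t
  · have key : ∀ (k : V →ₗ[ℚ] N) (x : N), 0 ≤ k t + q • x ↔ k (q⁻¹ • (-t)) ≤ x := fun k x => by
      rw [map_smul, inv_smul_le_iff_of_pos hq, map_neg, neg_le_iff_add_nonneg']
    rw [key, key, h1]

lemma exists_realize_term_eq (hf : f e = one N) (hg : g e = one N) {α : Type*} (t : Lloc.Term α)
    (s : α → V) : ∃ τ : V, t.realize (f ∘ s) = f τ ∧ t.realize (g ∘ s) = g τ := by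
  induction t with
  | var a => exact ⟨s a, rfl, rfl⟩
  | func F ts ih =>
    choose τ h1 h2 using ih
    simp only [Term.realize, h1, h2]
    cases F with
    | add =>
      refine ⟨τ 0 + τ 1, ?_, ?_⟩ <;> rw [map_add] <;>
        exact congrArg (Structure.funMap addSymb) (funext fun i => by fin_cases i <;> rfl)
    | neg =>
      refine ⟨-τ 0, ?_, ?_⟩ <;> rw [map_neg] <;>
        exact congrArg (Structure.funMap negSymb) (funext fun i => by fin_cases i; rfl)
    | one =>
      refine ⟨e, ?_, ?_⟩
      · rw [hf]; exact congrArg (Structure.funMap oneSymb) (Subsingleton.elim _ _)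
      · rw [hg]; exact congrArg (Structure.funMap oneSymb) (Subsingleton.elim _ _)

/-- Partial isomorphisms between small subspaces of a saturated model are elementary. -/
theorem realize_comp_iff (hκ : ℵ₀ < κ) (hN : IsSaturated Lloc κ N) {α : Type*} {n : ℕ}
    (φ : Lloc.BoundedFormula α n) : ∀ (V : Type u) [AddCommGroup V] [Module ℚ V]
    (f g : V →ₗ[ℚ] N) (e : V), #V < κ → f e = one N → g e = one N → (∀ t, 0 ≤ f t ↔ 0 ≤ g t) →
    ∀ (v : α → V) (xs : Fin n → V),
      φ.Realize (f ∘ v) (f ∘ xs) ↔ φ.Realize (g ∘ v) (g ∘ xs) := by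
  induction φ with
  | falsum => intros; rfl
  | equal t₁ t₂ =>
    intro V _ _ f g e _ hf hg h v xs
    obtain ⟨τ₁, h1, h1'⟩ := exists_realize_term_eq hf hg t₁ (Sum.elim v xs)
    obtain ⟨τ₂, h2, h2'⟩ := exists_realize_term_eq hf hg t₂ (Sum.elim v xs)
    simp only [BoundedFormula.Realize, ← Sum.comp_elim, h1, h2, h1', h2']
    exact map_eq_map_iff h _ _
  | rel Q ts =>
    intro V _ _ f g e _ hf hg h v xs
    choose τ h1 h2 using fun i => exists_realize_term_eq hf hg (ts i) (Sum.elim v xs)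
    simp only [BoundedFormula.Realize, ← Sum.comp_elim, h1, h2]
    cases Q with
    | R r =>
      have key : ∀ k : V →ₗ[ℚ] N, Structure.RelMap (RSymb r) (fun i => k (τ i)) ↔
          R r (k (τ 0)) (k (τ 1)) := fun k => by
        refine iff_of_eq (congrArg (Structure.RelMap (RSymb r)) (funext fun i => ?_))
        fin_cases i <;> rfl
      refine (key f).trans (Iff.trans ?_ (key g).symm)
      rw [loc_R_iff, loc_R_iff, ← map_add_smul_one hf, ← map_add_smul_one hg, map_le_map_iff h,
        map_le_map_iff h]
  | imp φ ψ ih1 ih2 =>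
    intro V _ _ f g e hV hf hg h v xs
    simp only [BoundedFormula.realize_imp, ih1 V f g e hV hf hg h, ih2 V f g e hV hf hg h]
  | all φ ih =>
    have key : ∀ (V : Type u) [AddCommGroup V] [Module ℚ V]
        (f g : V →ₗ[ℚ] N) (e : V), #V < κ → f e = one N → g e = one N →
        (∀ t, 0 ≤ f t ↔ 0 ≤ g t) → ∀ (v : _ → V) (xs : Fin _ → V),
        φ.all.Realize (g ∘ v) (g ∘ xs) → φ.all.Realize (f ∘ v) (f ∘ xs) := by
      intro V _ _ f g e hV hf hg h v xs hr
      rw [BoundedFormula.realize_all] at hr ⊢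
      intro b
      -- A counterpart `c` of `b` extends both maps to `V × ℚ`, to which the induction hypothesis
      -- applies; the extended maps need not be injective.
      obtain ⟨c, h1, h2⟩ := exists_same_cut hN hV hf h b
      have hV' : #(V × ℚ) < κ := by
        rw [mk_prod]
        exact mul_lt_of_lt hκ.le (by simpa using hV) (by simpa using hκ)
      have := ih (V × ℚ) (extendMap f b) (extendMap g c) (e, 0) hV' (by simpa using hf)
        (by simpa using hg) (nonneg_extendMap_iff h h1 h2) (fun i => (v i, 0))
        (Fin.snoc (fun i => (xs i, 0)) (0, 1))
      have e1 : ∀ (k : V →ₗ[ℚ] N) (x : N), extendMap k x ∘ (fun i => (v i, (0 : ℚ))) = k ∘ v :=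
        fun k x => by ext; simp
      have e2 : ∀ (k : V →ₗ[ℚ] N) (x : N),
          extendMap k x ∘ (Fin.snoc (fun i => (xs i, (0 : ℚ))) (0, 1) : Fin (_ + 1) → V × ℚ) =
            Fin.snoc (k ∘ xs) x := fun k x => by
        rw [Fin.comp_snoc]
        congr 1
        · ext; simp
        · simp
      rw [e1, e1, e2, e2] at this
      exact this.2 (hr c)
    intro V _ _ f g e hV hf hg h v xs
    exact ⟨key V g f e hV hg hf (fun t => (h t).symm) v xs, key V f g e hV hf hg h v xs⟩

/-- Partial isomorphisms between small subspaces of a monster model extend to automorphisms. -/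
theorem exists_equiv_comp_eq (hκ : ℵ₀ < κ) (hN : IsSaturated Lloc κ N)
    (hN' : IsStronglyHomogeneous Lloc κ N) (hV : #V < κ) (hf : f e = one N) (hg : g e = one N)
    (h : ∀ t, 0 ≤ f t ↔ 0 ≤ g t) : ∃ σ : N ≃[Lloc] N, ∀ t, σ (f t) = g t :=
  hN'.exists_equiv hV f g fun φ => by
    have := realize_comp_iff hκ hN φ V f g e hV hf hg h id default
    rwa [Unique.eq_default (f ∘ default), Unique.eq_default (g ∘ default)] at this

end Extension

/-! ### Automorphisms acting on types and quotient classes -/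

section Invariance

variable {L : FirstOrder.Language.{0, 0}} {N : Type u} [L.Structure N]

lemma realize_comp_equiv_iff {A : Set N} {σ : N ≃[L] N} (hσ : ∀ c ∈ A, σ c = c) {α : Type}
    (φ : L[[A]].Formula α) (v : α → N) : φ.Realize (σ ∘ v) ↔ φ.Realize v := by
  unfold Formula.Realize
  rw [← BoundedFormula.realize_constantsVarsEquiv, ← BoundedFormula.realize_constantsVarsEquiv]
  refine Iff.trans ?_ (StrongHomClass.realize_boundedFormula σ _)
  have : (σ ∘ fun a : A => ((L.con a : L[[A]].Constants) : N)) = fun a => (L.con a : N) :=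
    funext fun a => by simp [hσ a a.2]
  rw [Sum.comp_elim, this, Unique.eq_default (σ ∘ default)]

lemma symm_fixes {A : Set N} {σ : N ≃[L] N} (hσ : ∀ c ∈ A, σ c = c) :
    ∀ c ∈ A, σ.symm c = c := fun c hc => by
  conv_lhs => rw [← hσ c hc]
  exact σ.symm_apply_apply c

lemma mem_realizations_of_equiv [Nonempty N] {A : Set N} {p : TypeOver (L := L) A}
    {σ : N ≃[L] N} (hσ : ∀ c ∈ A, σ c = c) {x : N} (hx : x ∈ realizations p) :
    σ x ∈ realizations p :=
  fun φ hφ => (realize_comp_equiv_iff hσ φ fun _ => x).2 (hx φ hφ)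

/-- `F` is invariant under the automorphisms fixing `A` pointwise. -/
def IsAutInvariant (A : Set N) {X : Set N} (F : Setoid X) : Prop :=
  ∀ σ : N ≃[L] N, (∀ c ∈ A, σ c = c) → ∀ x y x' y' : X, σ x = x' → σ y = y' → F x y → F x' y'

lemma IsRelTypeDefOver.isAutInvariant {A B X : Set N} {F : Setoid X}
    (hF : IsRelTypeDefOver L B F) (hB : B ⊆ A) : IsAutInvariant (L := L) A F := by
  obtain ⟨π, hπ⟩ := hF
  intro σ hσ x y x' y' hx hy h
  rw [hπ] at h ⊢
  intro φ hφ
  rw [← hx, ← hy, show ![σ (x : N), σ (y : N)] = σ ∘ ![(x : N), (y : N)] by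
    ext i; fin_cases i <;> rfl, realize_comp_equiv_iff fun c hc => hσ c (hB hc)]
  exact h φ hφ

lemma mem_classSet {X : Set N} {F : Setoid X} {x : N} {y : X} :
    x ∈ classSet (Quotient.mk F y) ↔ ∃ hx : x ∈ X, F ⟨x, hx⟩ y := by
  constructor
  · rintro ⟨z, hz, rfl⟩
    exact ⟨z.2, Quotient.exact hz⟩
  · rintro ⟨hx, h⟩
    exact ⟨⟨x, hx⟩, Quotient.sound h, rfl⟩

lemma image_classSet [Nonempty N] {A : Set N} {p : TypeOver (L := L) A}
    {F : Setoid (realizations p)} (hF : IsAutInvariant (L := L) A F) {σ : N ≃[L] N}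
    (hσ : ∀ c ∈ A, σ c = c) {x y : realizations p}
    (hxy : F ⟨σ x, mem_realizations_of_equiv hσ x.2⟩ y) :
    σ '' classSet (Quotient.mk F x) = classSet (Quotient.mk F y) := by
  ext z
  simp only [Set.mem_image, mem_classSet]
  constructor
  · rintro ⟨w, ⟨hw, h⟩, rfl⟩
    exact ⟨mem_realizations_of_equiv hσ hw, F.trans (hF σ hσ _ _ _ _ rfl rfl h) hxy⟩
  · rintro ⟨hz, h⟩
    refine ⟨σ.symm z, ⟨mem_realizations_of_equiv (symm_fixes hσ) hz, ?_⟩, σ.apply_symm_apply z⟩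
    exact hF σ.symm (symm_fixes hσ) _ _ _ _ rfl (σ.symm_apply_apply _) (F.trans h (F.symm hxy))

lemma rel_of_image_classSet [Nonempty N] {A : Set N} {p : TypeOver (L := L) A}
    {F : Setoid (realizations p)} {σ : N ≃[L] N} (hσ : ∀ c ∈ A, σ c = c) {x y : realizations p}
    (h : σ '' classSet (Quotient.mk F x) = classSet (Quotient.mk F y)) :
    F ⟨σ x, mem_realizations_of_equiv hσ x.2⟩ y := by
  have h1 : σ x ∈ classSet (Quotient.mk F y) := by
    rw [← h]
    exact ⟨x, mem_classSet.2 ⟨x.2, F.refl _⟩, rfl⟩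
  exact (mem_classSet.1 h1).2

end Invariance

/-! ### Compatibility with the symbols of the language -/

section Symbols

variable {N : Type u} [Lloc.Structure N]

lemma equiv_one (σ : N ≃[Lloc] N) : σ (one N) = one N :=
  (σ.map_fun oneSymb ![]).trans (congrArg (Structure.funMap oneSymb) (Subsingleton.elim _ _))

lemma equiv_R_iff (σ : N ≃[Lloc] N) {r : {q : ℚ // 0 < q}} {x y : N} :
    R r (σ x) (σ y) ↔ R r x y := by
  refine Iff.trans (iff_of_eq (congrArg (Structure.RelMap (RSymb r)) ?_))
    (σ.map_rel (RSymb r) ![x, y])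
  ext i; fin_cases i <;> rfl

lemma coe_one_model (M : Lloc.ElementarySubstructure N) : ((one M : M) : N) = one N :=
  congrArg (Structure.funMap oneSymb) (Subsingleton.elim _ _)

end Symbols

/-! ### Far elements and large infinitesimals over a subspace -/

section Subspaces

variable {N : Type u} [Lloc.Structure N] [Nonempty N] [N ⊨ Tloc]

attribute [local instance] locAddCommGroup locModule locPartialOrder loc_isOrderedAddMonoid
  loc_isStrictOrderedModule

/-- An automorphism of a model of `Tloc` is linear over `ℚ`. -/
noncomputable def equivLinearMap (σ : N ≃[Lloc] N) : N →ₗ[ℚ] N :=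
  (AddMonoidHom.mk' σ fun x y => by
    refine (σ.map_fun addSymb ![x, y]).trans (congrArg (Structure.funMap addSymb) ?_)
    ext i; fin_cases i <;> rfl).toRatLinearMap

@[simp] lemma equivLinearMap_apply (σ : N ≃[Lloc] N) (x : N) : equivLinearMap σ x = σ x := rfl

lemma equiv_add (σ : N ≃[Lloc] N) (x y : N) : σ (x + y) = σ x + σ y :=
  map_add (equivLinearMap σ) x y

lemma equiv_sub (σ : N ≃[Lloc] N) (x y : N) : σ (x - y) = σ x - σ y :=
  map_sub (equivLinearMap σ) x y

lemma equiv_smul (σ : N ≃[Lloc] N) (q : ℚ) (x : N) : σ (q • x) = q • σ x :=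
  map_smul (equivLinearMap σ) q x

lemma equiv_le_iff (σ : N ≃[Lloc] N) {x y : N} : σ x ≤ σ y ↔ x ≤ y :=
  exists_congr fun _ => equiv_R_iff σ

lemma equiv_lt_iff (σ : N ≃[Lloc] N) {x y : N} : σ x < σ y ↔ x < y :=
  lt_iff_lt_of_le_iff_le' (equiv_le_iff σ) (equiv_le_iff σ)

variable {κ : Cardinal.{u}}

lemma mk_span_lt (hκ : ℵ₀ < κ) {s : Set N} (hs : #s < κ) : #(Submodule.span ℚ s) < κ := by
  have h1 : #(Submodule.span ℚ s) ≤ #(s →₀ ℚ) := by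
    rw [Finsupp.span_eq_range_linearCombination]
    exact mk_range_le
  refine h1.trans_lt ?_
  rcases isEmpty_or_nonempty s with h | h
  · rw [mk_eq_one]
    exact one_lt_aleph0.trans hκ
  · rw [mk_finsupp_lift_of_infinite']
    simpa using ⟨hs, hκ⟩

lemma mk_sup_span_lt (hκ : ℵ₀ < κ) {D : Submodule ℚ N} (hD : #D < κ) (x : N) :
    #(D ⊔ Submodule.span ℚ {x} : Submodule ℚ N) < κ := by
  have h1 := mk_span_lt hκ (s := (D : Set N) ∪ {x})
    ((mk_union_le _ _).trans_lt (add_lt_of_lt hκ.le hD (by simpa using one_lt_aleph0.trans hκ)))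
  rwa [Submodule.span_union, Submodule.span_eq] at h1

/-- Elements with the same cut over a small subspace are conjugate over it. -/
lemma exists_equiv_of_same_cut (hκ : ℵ₀ < κ) (hN : IsSaturated Lloc κ N)
    (hN' : IsStronglyHomogeneous Lloc κ N)
    {D : Submodule ℚ N} (hD : #D < κ) (h1D : one N ∈ D) {y y' : N}
    (h1 : ∀ d ∈ D, d ≤ y ↔ d ≤ y') (h2 : ∀ d ∈ D, y ≤ d ↔ y' ≤ d) :
    ∃ σ : N ≃[Lloc] N, (∀ d ∈ D, σ d = d) ∧ σ y = y' := by
  have hV : #(D × ℚ) < κ := by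
    rw [mk_prod]
    exact mul_lt_of_lt hκ.le (by simpa using hD) (by simpa using hκ)
  obtain ⟨σ, hσ⟩ := exists_equiv_comp_eq (V := D × ℚ) (f := extendMap D.subtype y)
    (g := extendMap D.subtype y') (e := (⟨one N, h1D⟩, 0)) hκ hN hN' hV (by simp) (by simp)
    (nonneg_extendMap_iff (fun _ => Iff.rfl) (fun t => h1 t t.2) (fun t => h2 t t.2))
  refine ⟨σ, fun d hd => ?_, ?_⟩
  · simpa using hσ (⟨d, hd⟩, 0)
  · simpa using hσ (0, 1)

/-- `x` is at infinite distance from all elements of `D`. -/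
def IsFar (D : Set N) (x : N) : Prop := ∀ d ∈ D, ¬ d ≤ x ∧ ¬ x ≤ d

/-- Every comparison with an element of `D` fails for both, so the cuts agree vacuously. -/
lemma IsFar.exists_equiv (hκ : ℵ₀ < κ) (hN : IsSaturated Lloc κ N)
    (hN' : IsStronglyHomogeneous Lloc κ N)
    {D : Submodule ℚ N} (hD : #D < κ) (h1D : one N ∈ D) {y y' : N}
    (hy : IsFar D y) (hy' : IsFar D y') :
    ∃ σ : N ≃[Lloc] N, (∀ d ∈ D, σ d = d) ∧ σ y = y' :=
  exists_equiv_of_same_cut hκ hN hN' hD h1D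
    (fun d hd => iff_of_false (hy d hd).1 (hy' d hd).1)
    (fun d hd => iff_of_false (hy d hd).2 (hy' d hd).2)

variable (N) in
/-- The group of infinitesimals. -/
def infinitesimals : AddSubgroup N where
  carrier := {z | ∀ r : ℚ, 0 < r → z ≤ r • one N ∧ -z ≤ r • one N}
  zero_mem' r hr := by
    rw [neg_zero]
    exact ⟨smul_nonneg hr.le loc_zero_le_one, smul_nonneg hr.le loc_zero_le_one⟩
  neg_mem' h r hr := by
    rw [neg_neg]
    exact (h r hr).symm
  add_mem' h1 h2 r hr := by
    have h3 := h1 (r / 2) (half_pos hr)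
    have h4 := h2 (r / 2) (half_pos hr)
    have e : r • one N = (r / 2) • one N + (r / 2) • one N := by rw [← add_smul, add_halves]
    rw [neg_add, e]
    exact ⟨add_le_add h3.1 h4.1, add_le_add h3.2 h4.2⟩

lemma mem_infinitesimals {z : N} :
    z ∈ infinitesimals N ↔ ∀ r : ℚ, 0 < r → z ≤ r • one N ∧ -z ≤ r • one N := Iff.rfl

lemma infSetoid_iff {x y : N} : infSetoid N x y ↔ y - x ∈ infinitesimals N := by
  have key : ∀ r : ℚ, (y - x ≤ r • one N ∧ -(y - x) ≤ r • one N) ↔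
      (y ≤ x + r • one N ∧ x ≤ y + r • one N) := fun r => by
    rw [neg_sub, sub_le_iff_le_add', sub_le_iff_le_add']
  constructor
  · intro h
    rw [mem_infinitesimals]
    intro r hr
    have h1 : S ⟨r, hr⟩ x y := h ⟨r, hr⟩
    rw [loc_S_iff] at h1
    exact (key r).2 h1
  · intro h
    rw [mem_infinitesimals] at h
    change ∀ r, S r x y
    exact fun r => loc_S_iff.2 ((key r).1 (h r r.2))

lemma equiv_mem_infinitesimals {σ : N ≃[Lloc] N} {z : N} (hz : z ∈ infinitesimals N) :
    σ z ∈ infinitesimals N := fun r hr => by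
  have h := hz r hr
  have h1 := (equiv_le_iff σ).2 h.1
  have h2 := (equiv_le_iff σ).2 h.2
  rw [equiv_smul, equiv_one] at h1 h2
  exact ⟨h1, (map_neg (equivLinearMap σ) z).symm.trans_le h2⟩

lemma IsPosInfinitesimal.mem {a : N} (ha : IsPosInfinitesimal a) :
    a ∈ infinitesimals N ∧ 0 < a := by
  have h0 : (0 : N) ≤ a := ⟨_, ha.2 ⟨1, one_pos⟩⟩
  refine ⟨fun r hr => ⟨?_, ?_⟩, lt_of_le_of_ne h0 ha.1.symm⟩
  · have h1 : a ≤ 0 + r • one N := (loc_R_iff.1 (ha.2 ⟨r, hr⟩)).2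
    rwa [zero_add] at h1
  · exact (neg_nonpos.2 h0).trans (smul_nonneg hr.le loc_zero_le_one)

/-- A translation by at most `1` cannot create comparability, because `D` is closed under adding `±
1`. -/
lemma IsFar.add_infinitesimal {D : Submodule ℚ N} (h1D : one N ∈ D) {x z : N} (hx : IsFar D x)
    (hz : z ∈ infinitesimals N) : IsFar D (x + z) := fun d hd => by
  have h := hz 1 one_pos
  rw [one_smul] at h
  refine ⟨fun h1 => (hx _ (D.sub_mem hd h1D)).1 ?_, fun h1 => (hx _ (D.add_mem hd h1D)).2 ?_⟩
  · rw [sub_le_iff_le_add]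
    exact h1.trans (add_le_add_right h.1 x)
  · rw [← sub_le_iff_le_add]
    refine le_trans ?_ h1
    rw [sub_le_iff_le_add, add_assoc, le_add_iff_nonneg_right, ← neg_le_iff_add_nonneg']
    exact h.2

/-- `z` is an infinitesimal larger than all infinitesimals of `D`. -/
def IsLargeInfinitesimal (D : Set N) (z : N) : Prop :=
  z ∈ infinitesimals N ∧ ∀ d ∈ D, d ∈ infinitesimals N → d < z

lemma exists_isLargeInfinitesimal (hN : IsSaturated Lloc κ N)
    {D : Submodule ℚ N} (hD : #D < κ) :
    ∃ z, IsLargeInfinitesimal (D : Set N) z := by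
  classical
  obtain ⟨z, hz⟩ := hN.exists_forall_mem (A := (D : Set N)) hD
    (ι := {d : D // (d : N) ∈ infinitesimals N} × {r : ℚ // 0 < r})
    (P := fun p => {z | (R ⟨1, one_pos⟩ (p.1.1 : N) z ∧ z ≠ p.1.1) ∧ R p.2 0 z})
    (fun p => Set.Definable.inter (Set.Definable.inter (definable_R_left p.1.1.2 _)
      (definable_ne p.1.1.2)) (definable_R_left D.zero_mem _))
    (fun T => by
      obtain ⟨r, hr⟩ : ∃ r : {r : ℚ // 0 < r}, ∀ q ∈ T.image Prod.snd, r ≤ q :=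
        Finset.exists_le (α := {r : ℚ // 0 < r}ᵒᵈ) _
      -- The bound `r` handles the finitely many smallness conditions. The bound `1/2` gives `s • 1
      -- ≤ d + 1` for infinitesimal `d`, as required by `R_1(d, s • 1)`.
      set s : ℚ := min r 2⁻¹ with hs
      have hs0 : 0 < s := lt_min r.2 (by norm_num)
      have hu := loc_zero_lt_one (N := N)
      refine ⟨s • one N, fun p hp => ⟨?_, ?_⟩⟩
      · have h1 : (p.1.1 : N) < s • one N := (p.1.2 _ (half_pos hs0)).1.trans_lt
          ((smul_lt_smul_iff_of_pos_right hu).2 (half_lt_self hs0))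
        refine ⟨loc_R_iff.2 ⟨h1.le, ?_⟩, h1.ne'⟩
        have h2 := (p.1.2 2⁻¹ (by norm_num)).2
        have h3 : s • one N ≤ (2⁻¹ : ℚ) • one N :=
          smul_le_smul_of_nonneg_right (min_le_right _ _) hu.le
        have h4 : (1 : ℚ) • one N = (2⁻¹ : ℚ) • one N + (2⁻¹ : ℚ) • one N := by
          rw [← add_smul]; norm_num
        change _ ≤ _ + (1 : ℚ) • one N
        rw [h4, ← add_assoc]
        exact h3.trans (le_add_of_nonneg_left (neg_le_iff_add_nonneg'.1 h2))
      · refine loc_R_iff.2 ⟨smul_nonneg hs0.le hu.le, ?_⟩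
        rw [zero_add]
        exact smul_le_smul_of_nonneg_right ((min_le_left _ _).trans
          (hr p.2 (Finset.mem_image_of_mem _ hp))) hu.le)
  refine ⟨z, fun r hr => ?_, fun d hd hd' => ?_⟩
  · have h := loc_R_iff.1 (hz (⟨0, (infinitesimals N).zero_mem⟩, ⟨r, hr⟩)).2
    rw [zero_add] at h
    exact ⟨h.2, (neg_nonpos.2 h.1).trans (smul_nonneg hr.le loc_zero_le_one)⟩
  · have h := (hz (⟨⟨d, hd⟩, hd'⟩, ⟨1, one_pos⟩)).1
    exact lt_of_le_of_ne (loc_R_iff.1 h.1).1 h.2.symm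

lemma mem_infinitesimals_of_equiv {σ : N ≃[Lloc] N} {z : N} (hz : σ z ∈ infinitesimals N) :
    z ∈ infinitesimals N := by
  have h := equiv_mem_infinitesimals (σ := σ.symm) hz
  rwa [σ.symm_apply_apply] at h

namespace IsLargeInfinitesimal

lemma map {D : Set N} {z : N} (h : IsLargeInfinitesimal D z) (σ : N ≃[Lloc] N) :
    IsLargeInfinitesimal (σ '' D) (σ z) := by
  refine ⟨equiv_mem_infinitesimals h.1, ?_⟩
  rintro _ ⟨d, hd, rfl⟩ hi
  exact (equiv_lt_iff σ).2 (h.2 d hd (mem_infinitesimals_of_equiv hi))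

lemma mono {D D' : Set N} {z : N} (h : IsLargeInfinitesimal D z) (hD : D' ⊆ D) :
    IsLargeInfinitesimal D' z := ⟨h.1, fun d hd => h.2 d (hD hd)⟩

lemma pos {D : Submodule ℚ N} {z : N} (h : IsLargeInfinitesimal (D : Set N) z) : 0 < z :=
  h.2 0 D.zero_mem (infinitesimals N).zero_mem

/-- A non-infinitesimal `d ≤ z` lies below some `-r • 1`, hence below every positive element such as
`z'`. With `ge_of_ge`, this shows that all large infinitesimals over `D` fill one cut. -/
lemma le_of_le {D : Submodule ℚ N} {z z' : N} (h : IsLargeInfinitesimal (D : Set N) z)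
    (h' : IsLargeInfinitesimal (D : Set N) z') {d : N} (hd : d ∈ D) (hdz : d ≤ z) : d ≤ z' := by
  by_cases hi : d ∈ infinitesimals N
  · exact (h'.2 d hd hi).le
  · rw [mem_infinitesimals] at hi
    push Not at hi
    obtain ⟨r, hr, h1⟩ := hi
    have h0 : (0 : N) ≤ r • one N := smul_nonneg hr.le loc_zero_le_one
    have h2 := h1 (hdz.trans (h.1 r hr).1)
    have h3 := (loc_total_of_le (neg_le_neg hdz) ((neg_nonpos.2 h.pos.le).trans h0)).resolve_left h2
    exact (neg_nonneg.1 (h0.trans h3)).trans h'.pos.le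

lemma ge_of_ge {D : Submodule ℚ N} {z z' : N} (h : IsLargeInfinitesimal (D : Set N) z)
    (h' : IsLargeInfinitesimal (D : Set N) z') {d : N} (hd : d ∈ D) (hdz : z ≤ d) : z' ≤ d := by
  by_cases hi : d ∈ infinitesimals N
  · exact absurd hdz (h.2 d hd hi).not_ge
  · rw [mem_infinitesimals] at hi
    push Not at hi
    obtain ⟨r, hr, h1⟩ := hi
    have h0 : (0 : N) ≤ r • one N := smul_nonneg hr.le loc_zero_le_one
    have h2 : ¬ d ≤ r • one N :=
      fun h2 => h1 h2 ((neg_nonpos.2 (h.pos.le.trans hdz)).trans h0)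
    exact (h'.1 r hr).1.trans ((loc_total_of_le hdz (h.1 r hr).1).resolve_left h2)

lemma exists_equiv (hκ : ℵ₀ < κ) (hN : IsSaturated Lloc κ N)
    (hN' : IsStronglyHomogeneous Lloc κ N)
    {D : Submodule ℚ N} (hD : #D < κ) (h1D : one N ∈ D) {z z' : N}
    (h : IsLargeInfinitesimal (D : Set N) z) (h' : IsLargeInfinitesimal (D : Set N) z') :
    ∃ σ : N ≃[Lloc] N, (∀ d ∈ D, σ d = d) ∧ σ z = z' :=
  exists_equiv_of_same_cut hκ hN hN' hD h1D
    (fun _ hd => ⟨h.le_of_le h' hd, h'.le_of_le h hd⟩)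
    (fun _ hd => ⟨h.ge_of_ge h' hd, h'.ge_of_ge h hd⟩)

/-- Adding an element far from `D` to `D` produces no new infinitesimals. -/
lemma sup_span_of_isFar {D : Submodule ℚ N} (h1D : one N ∈ D) {x z : N}
    (hx : IsFar D x) (h : IsLargeInfinitesimal (D : Set N) z) :
    IsLargeInfinitesimal (D ⊔ Submodule.span ℚ {x} : Submodule ℚ N) z := by
  refine ⟨h.1, fun d hd hi => ?_⟩
  obtain ⟨d', hd', w, hw, rfl⟩ := Submodule.mem_sup.1 hd
  obtain ⟨q, rfl⟩ := Submodule.mem_span_singleton.1 hw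
  have h1 := hi 1 one_pos
  rw [one_smul] at h1
  -- An element `t + c x` with `c > 0` bounded by `1` would place `x` below an element of `D`; so an
  -- infinitesimal of the larger space has no `x`-component.
  have key : ∀ c : ℚ, 0 < c → ∀ t ∈ D, ¬ t + c • x ≤ one N := fun c hc t ht h2 => by
    refine (hx (c⁻¹ • (one N - t)) (D.smul_mem _ (D.sub_mem h1D ht))).2 ?_
    rwa [le_inv_smul_iff_of_pos hc, le_sub_iff_add_le']
  rcases lt_trichotomy q 0 with hq | rfl | hq
  · refine absurd ?_ (key (-q) (neg_pos.2 hq) (-d') (D.neg_mem hd'))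
    rw [neg_smul, ← neg_add]
    exact h1.2
  · rw [zero_smul, add_zero] at hi ⊢
    exact h.2 d' hd' hi
  · exact absurd h1.1 (key q hq d' hd')

end IsLargeInfinitesimal

variable (M : Lloc.ElementarySubstructure N)

lemma coe_add_model (x y : M) : ((add x y : M) : N) = x + y :=
  congrArg (Structure.funMap addSymb) (funext fun i => by fin_cases i <;> rfl)

lemma coe_neg_model (x : M) : ((neg x : M) : N) = -(x : N) :=
  congrArg (Structure.funMap negSymb) (funext fun i => by fin_cases i; rfl)

lemma coe_zero_model : ((zero M : M) : N) = 0 := by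
  rw [zero, coe_add_model, coe_neg_model, add_neg_cancel]

lemma coe_nmul_model (n : ℕ) (x : M) : ((nmul n x : M) : N) = n • (x : N) := by
  induction n with
  | zero => rw [nmul, coe_zero_model, zero_smul]
  | succ n ih => rw [nmul, coe_add_model, ih, succ_nsmul]

/-- The additive subgroup underlying an elementary substructure. -/
def modelAddSubgroup : AddSubgroup N where
  carrier := M
  add_mem' hx hy := by
    have := (add (⟨_, hx⟩ : M) ⟨_, hy⟩).2
    rwa [coe_add_model] at this
  zero_mem' := by
    have := (zero M).2
    rwa [coe_zero_model] at this
  neg_mem' hx := by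
    have := (neg (⟨_, hx⟩ : M)).2
    rwa [coe_neg_model] at this

/-- The linear subspace underlying an elementary substructure. -/
def modelSubmodule : Submodule ℚ N where
  carrier := M
  add_mem' := (modelAddSubgroup M).add_mem
  zero_mem' := (modelAddSubgroup M).zero_mem
  smul_mem' q x hx := by
    have := loc_isAddTorsionFree (N := N)
    have h1 : q.num • x ∈ M := (modelAddSubgroup M).zsmul_mem hx q.num
    obtain ⟨y, hy⟩ := loc_exists_nmul_eq q.den_nz (⟨_, h1⟩ : M)
    have h2 : q.den • (y : N) = q.num • x := by
      rw [← coe_nmul_model, hy]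
    have h3 : q.den • (q • x) = q.num • x := den_ratSMul q x
    rw [show q • x = y from nsmul_right_injective q.den_nz (h3.trans h2.symm)]
    exact y.2

lemma one_mem_modelSubmodule : one N ∈ modelSubmodule M := by
  have := (one M).2
  rwa [coe_one_model] at this

end Subspaces

/-! ### Realizations of `p` are the elements far from `M` -/

section Realizations

/-- A finite part of `p` is realized in some model of the complete theory of `N`; its existential
closure therefore holds in `N`, and saturation does the rest. -/
lemma realizations_nonempty {L : FirstOrder.Language.{0, 0}} {N : Type u} [L.Structure N]
    [Nonempty N] {κ : Cardinal.{u}} (hN : IsSaturated L κ N) {A : Set N} (hA : #A < κ)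
    (p : TypeOver (L := L) A) : (realizations p).Nonempty := by
  refine hN A hA {φ | Formula.equivSentence φ ∈ p} fun s hs => ?_
  obtain ⟨K, v, hv⟩ := Theory.exists_modelType_is_realized_in _ p
  let ψ : L[[A]].Formula (Empty ⊕ Unit) :=
    Formula.relabel Sum.inr (s.toList.foldr (· ⊓ ·) ⊤ : L[[A]].Formula Unit)
  have hψ : ∀ (K : Type _) [L[[A]].Structure K] (w : Empty ⊕ Unit → K),
      ψ.Realize w ↔ ∀ φ ∈ s, φ.Realize (fun _ => w (Sum.inr ())) := fun K _ w => by
    rw [Formula.realize_relabel]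
    unfold Formula.Realize
    rw [BoundedFormula.realize_foldr_inf]
    simp only [Finset.mem_toList]
    rfl
  have h1 : K ⊨ ψ.iExs Unit := by
    refine Formula.realize_iExs.2 ⟨v, (hψ K _).2 fun φ hφ => ?_⟩
    have h2 := hs hφ
    rw [Set.mem_ofPred_eq, ← hv, Theory.CompleteType.formula_mem_typeOf] at h2
    exact h2
  have h2 : N ⊨ ψ.iExs Unit := by
    by_contra h2
    have h3 : ∼(ψ.iExs Unit) ∈ L[[A]].completeTheory N := h2
    exact (Theory.realize_sentence_of_mem (M := K) _ h3) h1
  obtain ⟨w, hw⟩ := Formula.realize_iExs.1 h2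
  exact ⟨w (), (hψ N _).1 hw⟩

variable {N : Type u} [Lloc.Structure N] [Nonempty N] [N ⊨ Tloc]

attribute [local instance] locAddCommGroup locModule locPartialOrder loc_isOrderedAddMonoid
  loc_isStrictOrderedModule

variable {M : Lloc.ElementarySubstructure N} {κ : Cardinal.{u}}
  {p : TypeOver (L := Lloc) (M : Set N)}

lemma isFar_of_mem_realizations (hp : ∀ φ ∈ unrelatedType (M : Set N), Formula.equivSentence φ ∈ p)
    {x : N} (hx : x ∈ realizations p) : IsFar (modelSubmodule M : Set N) x := by
  have key : ∀ c (hc : c ∈ M) r, ¬ R r x c ∧ ¬ R r c x := fun c hc r => by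
    have h := hx _ (hp _ ⟨⟨c, hc⟩, r, rfl⟩)
    rw [Formula.realize_inf, Formula.realize_not, Formula.realize_not, Formula.realize_rel₂,
      Formula.realize_rel₂, LHom.map_onRelation, LHom.map_onRelation, Term.realize_con,
      Term.realize_var] at h
    exact h
  exact fun c hc => ⟨fun ⟨r, hr⟩ => (key c hc r).2 hr, fun ⟨r, hr⟩ => (key c hc r).1 hr⟩

/-- Some realization exists, it is far from `M`, and any other far element is its image under an
automorphism fixing `M`. -/
lemma mem_realizations_of_isFar (hκ : ℵ₀ < κ) (hN : IsSaturated Lloc κ N)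
    (hN' : IsStronglyHomogeneous Lloc κ N) (hM : #M < κ)
    (hp : ∀ φ ∈ unrelatedType (M : Set N), Formula.equivSentence φ ∈ p) {x : N}
    (hx : IsFar (modelSubmodule M : Set N) x) : x ∈ realizations p := by
  obtain ⟨y, hy⟩ := realizations_nonempty hN hM p
  obtain ⟨σ, hσ, rfl⟩ := IsFar.exists_equiv hκ hN hN' (D := modelSubmodule M) hM
    (one_mem_modelSubmodule M) (isFar_of_mem_realizations hp hy) hx
  exact mem_realizations_of_equiv hσ hy

end Realizations

/-! ### Relative type-definability of `E` and `E_A` -/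

section TypeDefinable

variable {N : Type u} [Lloc.Structure N] [Nonempty N] [N ⊨ Tloc]

lemma isRelTypeDefOver_infSetoid (X : Set N) :
    IsRelTypeDefOver Lloc ∅ ((infSetoid N).comap (Subtype.val : X → N)) := by
  refine ⟨Set.range fun r => (Lloc.lhomWithConstants (∅ : Set N)).onFormula
    ((RSymb r).formula₂ (Term.var 0) (Term.var 1) ⊔ (RSymb r).formula₂ (Term.var 1) (Term.var 0)),
    fun x y => ?_⟩
  rw [Set.forall_mem_range]
  refine forall_congr' fun r => ?_
  rw [LHom.realize_onFormula, Formula.realize_sup, Formula.realize_rel₂, Formula.realize_rel₂]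
  rfl

lemma isRelTypeDefOver_setoidA (X : Set N) {A : Set N} (hA : ∀ a ∈ A, IsPosInfinitesimal a) :
    IsRelTypeDefOver Lloc A ((setoidA A hA).comap (Subtype.val : X → N)) := by
  let t (n : ℕ) (i j : Fin 2) : Lloc[[A]].Term (Fin 2) := (Lloc.lhomWithConstants A).onTerm
    (tnmul n (tadd (Term.var i) (tneg (Term.var j))))
  let φ (a : A) (n : ℕ) (i j : Fin 2) : Lloc[[A]].Formula (Fin 2) :=
    Relations.formula₂ ((Lloc.lhomWithConstants A).onRelation (RSymb ⟨1, one_pos⟩)) (t n i j)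
      (Lloc.con a).term
  have hφ : ∀ a n i j (v : Fin 2 → N), (φ a n i j).Realize v ↔
      R ⟨1, one_pos⟩ (nmul n (add (v i) (neg (v j)))) a := fun a n i j v => by
    rw [Formula.realize_rel₂, LHom.map_onRelation, LHom.realize_onTerm, realize_tnmul,
      realize_tadd, realize_tneg, Term.realize_con]
    rfl
  refine ⟨{ψ | ∃ (a : A) (n : ℕ), 1 ≤ n ∧ ψ = φ a n 0 1 ⊓ φ a n 1 0}, fun x y => ⟨?_, ?_⟩⟩
  · rintro h _ ⟨a, n, hn, rfl⟩
    rw [Formula.realize_inf, hφ, hφ]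
    exact h a a.2 n hn
  · intro h a ha n hn
    have := h _ ⟨⟨a, ha⟩, n, hn, rfl⟩
    rwa [Formula.realize_inf, hφ, hφ] at this

end TypeDefinable

/-! ### Stability of the quotient by `E` -/

section StableQuotient

variable {N : Type u} [Lloc.Structure N] [Nonempty N] [N ⊨ Tloc]

attribute [local instance] locAddCommGroup locModule locPartialOrder loc_isOrderedAddMonoid
  loc_isStrictOrderedModule

lemma loc_exists_approx {d x : N} (h : d ≤ x ∨ x ≤ d) {r : ℚ} (hr : 0 < r) :
    ∃ s : ℚ, d + s • one N ≤ x ∧ x ≤ d + (s + r) • one N := by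
  obtain ⟨k, hk⟩ : ∃ k : ℚ, d + k • one N ≤ x := by
    rcases h with h | h
    · exact ⟨0, by rwa [zero_smul, add_zero]⟩
    · obtain ⟨k, -, hk⟩ := loc_exists_le h
      exact ⟨-k, by rwa [neg_smul, ← sub_eq_add_neg, sub_le_iff_le_add]⟩
  obtain ⟨l, -, hl⟩ := loc_exists_le hk
  -- The least number of steps of size `r` from `d + k • 1` needed to pass `x` brackets `x` in an
  -- interval of length `r`.
  have hex : ∃ n : ℕ, x ≤ d + (k + n * r) • one N := by
    obtain ⟨n, hn⟩ := exists_nat_ge (l / r)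
    refine ⟨n, hl.trans ?_⟩
    rw [add_assoc, ← add_smul]
    exact add_le_add_right (smul_le_smul_of_nonneg_right
      (add_le_add_right ((div_le_iff₀ hr).1 hn) k) loc_zero_le_one) d
  classical
  have hmin := fun m => Nat.find_min hex (m := m)
  have hspec := Nat.find_spec hex
  rcases hn : Nat.find hex with _ | m
  · rw [hn] at hspec
    refine ⟨k, hk, hspec.trans ?_⟩
    refine add_le_add_right (smul_le_smul_of_nonneg_right ?_ loc_zero_le_one) d
    simpa using hr.le
  · rw [hn] at hspec
    have h1 := hmin m (by omega)
    refine ⟨k + m * r, ?_, by convert hspec using 3; push_cast; ring⟩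
    have h2 : d + k • one N ≤ d + (k + m * r) • one N :=
      add_le_add_right (smul_le_smul_of_nonneg_right
        (le_add_of_nonneg_right (by positivity)) loc_zero_le_one) d
    exact (loc_total_of_le hk h2).resolve_left h1

/-- The rational brackets of `x` around `d` are preserved by automorphisms, so the image of `d`
determines that of `x` up to every positive rational error. -/
lemma sub_mem_infinitesimals_of_eq {σ σ' : N ≃[Lloc] N} {d x : N} (hd : σ d = σ' d)
    (h : d ≤ x ∨ x ≤ d) : σ' x - σ x ∈ infinitesimals N := by
  have key : ∀ τ τ' : N ≃[Lloc] N, τ d = τ' d → ∀ r : ℚ, 0 < r → τ x - τ' x ≤ r • one N := by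
    intro τ τ' hd r hr
    obtain ⟨s, h1, h2⟩ := loc_exists_approx h hr
    have h3 := (equiv_le_iff τ').2 h1
    have h4 := (equiv_le_iff τ).2 h2
    rw [equiv_add, equiv_smul, equiv_one] at h3 h4
    rw [sub_le_iff_le_add']
    refine h4.trans ?_
    rw [add_smul, ← add_assoc, hd]
    exact add_le_add_left h3 _
  rw [mem_infinitesimals]
  intro r hr
  rw [neg_sub]
  exact ⟨key _ _ hd.symm r hr, key _ _ hd r hr⟩

lemma strictMono_pair {i j : ℕ} (h : i < j) : StrictMono ![i, j] := fun x y hxy => by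
  fin_cases x <;> fin_cases y <;> simp_all

variable {M : Lloc.ElementarySubstructure N} {κ : Cardinal.{u}}
  {p : TypeOver (L := Lloc) (M : Set N)}

lemma infSetoid_isAutInvariant (X : Set N) :
    IsAutInvariant (L := Lloc) (M : Set N) ((infSetoid N).comap (Subtype.val : X → N)) :=
  (isRelTypeDefOver_infSetoid X).isAutInvariant (Set.empty_subset _)

/-- The subspace generated by `M` and a tuple. -/
noncomputable def spanOver (M : Lloc.ElementarySubstructure N) {β : Type u} (b : β → N) :
    Submodule ℚ N :=
  Submodule.span ℚ ((M : Set N) ∪ Set.range b)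

lemma equiv_eq_on_spanOver {β : Type u} {b : β → N} {σ σ' : N ≃[Lloc] N}
    (hσ : ∀ c ∈ M, σ c = c) (hσ' : ∀ c ∈ M, σ' c = c) (h : ∀ k, σ (b k) = σ' (b k)) {d : N}
    (hd : d ∈ spanOver M b) : σ d = σ' d := by
  refine LinearMap.eqOn_span (f := equivLinearMap σ) (g := equivLinearMap σ') ?_ hd
  rintro x (hx | ⟨k, rfl⟩)
  · exact (hσ x hx).trans (hσ' x hx).symm
  · exact h k

lemma rel_of_near {β : Type u} {b b' : β → N} {x y z : realizations p}
    {σ σ' : N ≃[Lloc] N} (hσ : ∀ c ∈ M, σ c = c) (hσ' : ∀ c ∈ M, σ' c = c)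
    (hb : ∀ k, σ (b k) = b' k) (hb' : ∀ k, σ' (b k) = b' k)
    (hx : ¬ IsFar (spanOver M b : Set N) x)
    (h : σ '' classSet (Quotient.mk ((infSetoid N).comap Subtype.val) x) =
      classSet (Quotient.mk ((infSetoid N).comap Subtype.val) y))
    (h' : σ' '' classSet (Quotient.mk ((infSetoid N).comap Subtype.val) x) =
      classSet (Quotient.mk ((infSetoid N).comap Subtype.val) z)) :
    infSetoid N y z := by
  have h1 : infSetoid N (σ x) y := rel_of_image_classSet hσ h
  have h2 : infSetoid N (σ' x) z := rel_of_image_classSet hσ' h'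
  unfold IsFar at hx
  push Not at hx
  obtain ⟨d, hd, hdx⟩ := hx
  have h3 : infSetoid N (σ x) (σ' x) := infSetoid_iff.2 (sub_mem_infinitesimals_of_eq
    (equiv_eq_on_spanOver hσ hσ' (fun k => (hb k).trans (hb' k).symm) hd) (by tauto))
  exact (infSetoid N).trans ((infSetoid N).symm h1) ((infSetoid N).trans h3 h2)

/-- By `rel_of_near`, moving `x_i` while keeping the image of `b_j` fixed does not change its class.
For `i < j` the index pair `(i, j)` is sent to `(i, j+1)` and `(j, j+1)`. For `i > j` only `x_i E
x_{i+1}` results directly, and indiscernibility carries it to the pair `(j, i)`. -/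
lemma rel_of_isIndiscernible_of_near {β : Type u} {b : ℕ → β → N} {x : ℕ → realizations p}
    (hind : IsIndiscernible Lloc (M : Set N)
      (fun k => Quotient.mk ((infSetoid N).comap Subtype.val) (x k)) b) {i j : ℕ} (hij : i ≠ j)
    (hx : ¬ IsFar (spanOver M (b j) : Set N) (x i)) : infSetoid N (x i) (x j) := by
  rcases hij.lt_or_gt with h | h
  · obtain ⟨σ, hσ, h1, h2⟩ := hind 2 ![i, j] ![i, j + 1] (strictMono_pair h)
      (strictMono_pair (by omega))
    obtain ⟨σ', hσ', h1', h2'⟩ := hind 2 ![i, j] ![j, j + 1] (strictMono_pair h)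
      (strictMono_pair (by omega))
    exact rel_of_near hσ hσ' (h2 1) (h2' 1) hx (h1 0) (h1' 0)
  · obtain ⟨σ, hσ, h1, h2⟩ := hind 2 ![j, i] ![j, i] (strictMono_pair h) (strictMono_pair h)
    obtain ⟨σ', hσ', h1', h2'⟩ := hind 2 ![j, i] ![j, i + 1] (strictMono_pair h)
      (strictMono_pair (by omega))
    have h3 : infSetoid N (x i) (x (i + 1)) :=
      rel_of_near hσ hσ' (h2 0) (h2' 0) hx (h1 1) (h1' 1)
    obtain ⟨τ, hτ, h4, -⟩ := hind 2 ![i, i + 1] ![j, i] (strictMono_pair (by omega))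
      (strictMono_pair h)
    have h5 : infSetoid N (τ (x i)) (x j) := rel_of_image_classSet hτ (h4 0)
    have h6 : infSetoid N (τ (x (i + 1))) (x i) := rel_of_image_classSet hτ (h4 1)
    have h7 : infSetoid N (τ (x i)) (τ (x (i + 1))) := by
      rw [infSetoid_iff] at h3 ⊢
      rw [← equiv_sub]
      exact equiv_mem_infinitesimals h3
    exact (infSetoid N).trans ((infSetoid N).symm h6)
      ((infSetoid N).trans ((infSetoid N).symm h7) h5)

/-- The quotient by equality modulo infinitesimals is stable. -/
theorem isStableQuotient_infSetoid (hκ : ℵ₀ < κ) (hN : IsSaturated Lloc κ N)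
    (hN' : IsStronglyHomogeneous Lloc κ N) (hM : #M < κ) :
    IsStableQuotient Lloc κ (M : Set N)
      ((infSetoid N).comap (Subtype.val : realizations p → N)) := by
  intro β hβ a b hind i j hij
  choose x hx using fun k => Quotient.exists_rep (a k)
  obtain rfl : (fun k => Quotient.mk _ (x k)) = a := funext hx
  by_cases h1 : infSetoid N (x i) (x j)
  -- Here `a_i = a_j`, so an automorphism taking `(a_j, b_j)` to `(a_i, b_i)` already suffices.
  · obtain ⟨σ, hσ, h2, h3⟩ := hind 1 ![j] ![i] (Subsingleton.strictMono _)
      (Subsingleton.strictMono _)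
    have e : Quotient.mk ((infSetoid N).comap Subtype.val) (x i) = Quotient.mk _ (x j) :=
      Quotient.sound h1
    refine ⟨σ, hσ, fun _ => ?_, fun _ => h3 0⟩
    have h4 : σ '' classSet (Quotient.mk ((infSetoid N).comap Subtype.val) (x j)) =
      classSet (Quotient.mk _ (x i)) := h2 0
    beta_reduce
    rw [e] at h4 ⊢
    exact h4
  · have hi : IsFar (spanOver M (b j) : Set N) (x i) := by
      by_contra h
      exact h1 (rel_of_isIndiscernible_of_near hind hij h)
    have hj : IsFar (spanOver M (b i) : Set N) (x j) := by
      by_contra h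
      exact h1 ((infSetoid N).symm (rel_of_isIndiscernible_of_near hind hij.symm h))
    obtain ⟨σ, hσ, -, h3⟩ := hind 1 ![j] ![i] (Subsingleton.strictMono _)
      (Subsingleton.strictMono _)
    -- Once `σ` carries `b_j` to `b_i`, both `σ (x i)` and `x j` are far from the span of `M` and
    -- `b_i`; a second automorphism over that span joins them.
    have h4 : IsFar (spanOver M (b i) : Set N) (σ (x i)) := fun d hd => by
      have h5 : σ.symm d ∈ spanOver M (b j) := by
        have h6 : spanOver M (b i) ≤ (spanOver M (b j)).map (equivLinearMap σ) := by
          refine Submodule.span_le.2 ?_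
          rintro c (hc | ⟨k, rfl⟩)
          · exact ⟨c, Submodule.subset_span (Or.inl hc), hσ c hc⟩
          · exact ⟨b j k, Submodule.subset_span (Or.inr ⟨k, rfl⟩), h3 0 k⟩
        obtain ⟨c, hc, rfl⟩ := h6 hd
        rw [equivLinearMap_apply, σ.symm_apply_apply]
        exact hc
      have h7 := hi _ h5
      rwa [← equiv_le_iff σ, ← equiv_le_iff σ (x := (x i : N)), σ.apply_symm_apply] at h7
    have hcard : #(spanOver M (b i)) < κ :=
      mk_span_lt hκ ((mk_union_le _ _).trans_lt (add_lt_of_lt hκ.le hM (mk_range_le.trans_lt hβ)))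
    obtain ⟨τ, hτ, h5⟩ := IsFar.exists_equiv hκ hN hN' hcard
      (Submodule.subset_span (Or.inl (one_mem_modelSubmodule M))) h4 hj
    have hτσ : ∀ c ∈ (M : Set N), τ.comp σ c = c := fun c hc => by
      rw [Equiv.comp_apply, hσ c hc, hτ c (Submodule.subset_span (Or.inl hc))]
    refine ⟨τ.comp σ, hτσ, fun _ => image_classSet (infSetoid_isAutInvariant _) hτσ ?_,
      fun _ k => ?_⟩
    · change infSetoid N (τ (σ (x i))) (x j)
      rw [h5]
    · rw [Equiv.comp_apply, show σ (b j k) = b i k from h3 0 k]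
      exact hτ _ (Submodule.subset_span (Or.inr ⟨k, rfl⟩))

end StableQuotient

/-! ### Minimality of `E` and instability of `E_A` -/

section Finest

variable {N : Type u} [Lloc.Structure N] [Nonempty N] [N ⊨ Tloc]

attribute [local instance] locAddCommGroup locModule locPartialOrder loc_isOrderedAddMonoid
  loc_isStrictOrderedModule

variable {κ : Cardinal.{u}}

/-- A sequence of infinitesimals, each larger than all infinitesimals of the span of `D₀` and the
preceding ones, exists over every small subspace `D₀`. -/
lemma exists_largeInfinitesimal_seq (hκ : ℵ₀ < κ) (hN : IsSaturated Lloc κ N)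
    {D₀ : Submodule ℚ N} (hD₀ : #D₀ < κ) :
    ∃ (D : ℕ → Submodule ℚ N) (ε : ℕ → N), D 0 = D₀ ∧ (∀ k, #(D k) < κ) ∧
      (∀ k, D (k + 1) = D k ⊔ Submodule.span ℚ {ε k}) ∧
      ∀ k, IsLargeInfinitesimal (D k : Set N) (ε k) := by
  choose e he using fun D : {D : Submodule ℚ N // #D < κ} => exists_isLargeInfinitesimal hN D.2
  let D : ℕ → {D : Submodule ℚ N // #D < κ} := Nat.rec ⟨D₀, hD₀⟩
    fun _ D => ⟨D ⊔ Submodule.span ℚ {e D}, mk_sup_span_lt hκ D.2 _⟩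
  exact ⟨fun k => (D k).1, fun k => e (D k), rfl, fun k => (D k).2, fun k => rfl, fun k => he (D k)⟩

section Sequence

variable {D : ℕ → Submodule ℚ N} {ε : ℕ → N}

lemma subspace_monotone (hstep : ∀ k, D (k + 1) = D k ⊔ Submodule.span ℚ {ε k}) : Monotone D :=
  monotone_nat_of_le_succ fun k => by rw [hstep]; exact le_sup_left

lemma mem_subspace_of_lt (hstep : ∀ k, D (k + 1) = D k ⊔ Submodule.span ℚ {ε k}) {k n : ℕ}
    (h : k < n) : ε k ∈ D n := by
  refine subspace_monotone hstep h ?_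
  change ε k ∈ D (k + 1)
  rw [hstep]
  exact Submodule.mem_sup_right (Submodule.mem_span_singleton_self _)

/-- The automorphism is built one term at a time, as uniqueness of the large infinitesimal type
allows the next term to be moved without disturbing the earlier ones. -/
lemma exists_equiv_subsequence (hκ : ℵ₀ < κ) (hN : IsSaturated Lloc κ N)
    (hN' : IsStronglyHomogeneous Lloc κ N) (hcard : ∀ k, #(D k) < κ) (h1D : one N ∈ D 0)
    (hstep : ∀ k, D (k + 1) = D k ⊔ Submodule.span ℚ {ε k})
    (hε : ∀ k, IsLargeInfinitesimal (D k : Set N) (ε k)) (n : ℕ) (f : ℕ → ℕ)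
    (hf : ∀ i j, i < j → j < n → f i < f j) :
    ∃ σ : N ≃[Lloc] N, (∀ d ∈ D 0, σ d = d) ∧ ∀ k < n, σ (ε k) = ε (f k) := by
  have hmono := subspace_monotone hstep
  induction n with
  | zero =>
    exact ⟨FirstOrder.Language.Equiv.refl Lloc N, fun _ _ => rfl,
      fun k hk => absurd hk (Nat.not_lt_zero k)⟩
  | succ n ih =>
    obtain ⟨σ, hσ, hσε⟩ := ih fun i j hij hj => hf i j hij (by omega)
    -- This makes `ε (f n)` large over the image of `D n`, as `σ (ε n)` is, so the two are conjugate
    -- over that image.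
    have hle : ∀ k ≤ n, (D k).map (equivLinearMap σ) ≤ D (f k) := by
      intro k hk
      induction k with
      | zero =>
        rintro _ ⟨d, hd, rfl⟩
        rw [equivLinearMap_apply, hσ d hd]
        exact hmono (Nat.zero_le _) hd
      | succ k ih =>
        rw [hstep, Submodule.map_sup, Submodule.map_span, Set.image_singleton,
          equivLinearMap_apply, hσε k (by omega)]
        have hlt := hf k (k + 1) (by omega) (by omega)
        refine sup_le ((ih (by omega)).trans (hmono hlt.le)) (Submodule.span_le.2 ?_)
        rw [Set.singleton_subset_iff]
        exact mem_subspace_of_lt hstep hlt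
    have h1 := hσ _ h1D
    obtain ⟨τ, hτ, hτε⟩ := IsLargeInfinitesimal.exists_equiv hκ hN hN'
      (D := (D n).map (equivLinearMap σ)) (mk_image_le.trans_lt (hcard n))
      ⟨one N, hmono (Nat.zero_le n) h1D, h1⟩ ((hε n).map σ) ((hε (f n)).mono (hle n le_rfl))
    have hτσ : ∀ d ∈ D n, τ (σ d) = σ d := fun d hd => hτ _ ⟨d, hd, rfl⟩
    refine ⟨τ.comp σ, fun d hd => ?_, fun k hk => ?_⟩
    · rw [Equiv.comp_apply, hτσ d (hmono (Nat.zero_le n) hd), hσ d hd]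
    · rw [Equiv.comp_apply]
      rcases Nat.lt_succ_iff_lt_or_eq.1 hk with hk | rfl
      · rw [hτσ _ (mem_subspace_of_lt hstep hk), hσε k hk]
      · exact hτε

lemma exists_equiv_subsequences (hκ : ℵ₀ < κ) (hN : IsSaturated Lloc κ N)
    (hN' : IsStronglyHomogeneous Lloc κ N) (hcard : ∀ k, #(D k) < κ) (h1D : one N ∈ D 0)
    (hstep : ∀ k, D (k + 1) = D k ⊔ Submodule.span ℚ {ε k})
    (hε : ∀ k, IsLargeInfinitesimal (D k : Set N) (ε k)) {n : ℕ} {f g : Fin n → ℕ}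
    (hf : StrictMono f) (hg : StrictMono g) :
    ∃ σ : N ≃[Lloc] N, (∀ d ∈ D 0, σ d = d) ∧ ∀ k, σ (ε (f k)) = ε (g k) := by
  have key : ∀ f : Fin n → ℕ, StrictMono f →
      ∃ σ : N ≃[Lloc] N, (∀ d ∈ D 0, σ d = d) ∧ ∀ k : Fin n, σ (ε k) = ε (f k) := fun f hf => by
    obtain ⟨σ, hσ, h⟩ := exists_equiv_subsequence hκ hN hN' hcard h1D hstep hε n
      -- The value `0` outside `Fin n` is harmless: monotonicity is required only below `n`.
      (fun k => if hk : k < n then f ⟨k, hk⟩ else 0) (fun i j hij hj => by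
        rw [dif_pos (hij.trans hj), dif_pos hj]
        exact hf hij)
    refine ⟨σ, hσ, fun k => ?_⟩
    have := h k k.2
    rwa [dif_pos k.2] at this
  obtain ⟨σ, hσ, h⟩ := key f hf
  obtain ⟨τ, hτ, h'⟩ := key g hg
  -- Two subsequences are compared through the initial segment `ε 0, …, ε (n-1)`.
  refine ⟨τ.comp σ.symm, fun d hd => ?_, fun k => ?_⟩
  · rw [Equiv.comp_apply, symm_fixes (A := (D 0 : Set N)) hσ d hd, hτ d hd]
  · rw [Equiv.comp_apply, ← h k, σ.symm_apply_apply, h' k]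

end Sequence

variable {M : Lloc.ElementarySubstructure N} {p : TypeOver (L := Lloc) (M : Set N)}
  {F : Setoid (realizations p)}

/-- If some pair of realizations of `p` differing by an infinitesimal which is large over `M` is
in the invariant relation `F`, then so are all such pairs. -/
lemma rel_of_isLargeInfinitesimal (hκ : ℵ₀ < κ) (hN : IsSaturated Lloc κ N)
    (hN' : IsStronglyHomogeneous Lloc κ N) (hM : #M < κ)
    (hp : ∀ φ ∈ unrelatedType (M : Set N), Formula.equivSentence φ ∈ p)
    (hF : IsAutInvariant (L := Lloc) (M : Set N) F) {x y x' y' : realizations p}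
    (hxy : IsLargeInfinitesimal (M : Set N) ((y : N) - x))
    (hxy' : IsLargeInfinitesimal (M : Set N) ((y' : N) - x')) (h : F x y) : F x' y' := by
  have h1M := one_mem_modelSubmodule M
  obtain ⟨σ, hσ, hσx⟩ := IsFar.exists_equiv hκ hN hN' (D := modelSubmodule M) hM h1M
    (isFar_of_mem_realizations hp x.2) (isFar_of_mem_realizations hp x'.2)
  have hx' := isFar_of_mem_realizations hp x'.2
  have h1 : IsLargeInfinitesimal (modelSubmodule M : Set N) (σ (y - x)) := by
    refine ⟨equiv_mem_infinitesimals hxy.1, fun d hd hi => ?_⟩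
    rw [← hσ d hd]
    exact (equiv_lt_iff σ).2 (hxy.2 d hd hi)
  -- After `x` is moved to `x'`, the differences must be matched while fixing `x'`. Since `x'` is
  -- far from `M`, adjoining it adds no infinitesimals and both differences stay large.
  obtain ⟨τ, hτ, hτy⟩ := IsLargeInfinitesimal.exists_equiv hκ hN hN'
    (mk_sup_span_lt hκ (D := modelSubmodule M) hM (x' : N)) (Submodule.mem_sup_left h1M)
    (h1.sup_span_of_isFar h1M hx') (IsLargeInfinitesimal.sup_span_of_isFar h1M hx' hxy')
  have hτx : τ x' = x' :=
    hτ _ (Submodule.mem_sup_right (Submodule.mem_span_singleton_self _))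
  refine hF (τ.comp σ) (fun c hc => ?_) x y x' y' ?_ ?_ h
  · rw [Equiv.comp_apply, hσ c hc, hτ c (Submodule.mem_sup_left hc)]
  · rw [Equiv.comp_apply, hσx, hτx]
  · rw [Equiv.comp_apply]
    rw [equiv_sub, hσx, equiv_sub, hτx] at hτy
    exact sub_left_injective hτy

/-- If an invariant relation has a stable quotient, then it contains a pair of elements differing
by an infinitesimal which is large over `M`. -/
lemma exists_rel_of_isStableQuotient (hκ : ℵ₀ < κ) (hN : IsSaturated Lloc κ N)
    (hN' : IsStronglyHomogeneous Lloc κ N) (hM : #M < κ)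
    (hp : ∀ φ ∈ unrelatedType (M : Set N), Formula.equivSentence φ ∈ p)
    (hF : IsAutInvariant (L := Lloc) (M : Set N) F)
    (hst : IsStableQuotient Lloc κ (M : Set N) F) :
    ∃ x y : realizations p, IsLargeInfinitesimal (M : Set N) ((y : N) - x) ∧ F x y := by
  have h1M := one_mem_modelSubmodule M
  obtain ⟨x, hx⟩ := realizations_nonempty hN hM p
  have hxfar := isFar_of_mem_realizations hp hx
  obtain ⟨D, ε, hD0, hcard, hstep, hε⟩ := exists_largeInfinitesimal_seq hκ hN
    (mk_sup_span_lt hκ (D := modelSubmodule M) hM x)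
  have hMD : modelSubmodule M ≤ D 0 := hD0 ▸ le_sup_left
  have hxD : x ∈ D 0 := hD0 ▸ Submodule.mem_sup_right (Submodule.mem_span_singleton_self _)
  have hmem : ∀ k, x + ε k ∈ realizations p := fun k =>
    mem_realizations_of_isFar hκ hN hN' hM hp (hxfar.add_infinitesimal h1M (hε k).1)
  have hind : IsIndiscernible Lloc (M : Set N)
      (fun k => Quotient.mk F ⟨x + ε k, hmem k⟩) (fun k (_ : PUnit.{u + 1}) => x + ε k) := by
    intro n f g hf hg
    obtain ⟨σ, hσ, h⟩ := exists_equiv_subsequences hκ hN hN' hcard (hMD h1M) hstep hε hf hg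
    have hk : ∀ k, σ (x + ε (f k)) = x + ε (g k) := fun k => by
      rw [equiv_add, hσ x hxD, h]
    refine ⟨σ, fun c hc => hσ c (hMD hc), fun k => ?_, fun k _ => hk k⟩
    refine image_classSet hF (fun c hc => hσ c (hMD hc)) ?_
    simp only [hk]
    exact F.refl _
  obtain ⟨σ, hσ, h1, h2⟩ := hst PUnit (by simpa using one_lt_aleph0.trans hκ) _ _ hind 0 1 (by simp)
  have hrel := rel_of_image_classSet hσ (h1 ())
  have h2' : σ (x + ε 1) = x + ε 0 := h2 () PUnit.unit
  refine ⟨_, _, ?_, hrel⟩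
  -- Stability supplies `σ` with `σ (x + ε 1) = x + ε 0` and `σ (x + ε 0)` in the class of `x + ε
  -- 1`. The difference of this last pair telescopes into a large infinitesimal plus a positive one.
  have e : x + ε 1 - σ (x + ε 0) = (ε 1 - ε 0) + σ (ε 1 - ε 0) := by
    have e1 : σ (ε 1 - ε 0) = σ (x + ε 1) - σ (x + ε 0) := by
      rw [← equiv_sub, add_sub_add_left_eq_sub]
    rw [e1, h2']
    abel
  have hinf : ε 1 - ε 0 ∈ infinitesimals N := (infinitesimals N).sub_mem (hε 1).1 (hε 0).1
  have hlt : ∀ d ∈ M, d ∈ infinitesimals N → d < ε 1 - ε 0 := fun d hd hi => by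
    rw [lt_sub_iff_add_lt]
    exact (hε 1).2 _ (Submodule.add_mem _ (subspace_monotone hstep (Nat.zero_le 1) (hMD hd))
      (mem_subspace_of_lt hstep one_pos)) ((infinitesimals N).add_mem hi (hε 0).1)
  have hpos : 0 < ε 1 - ε 0 := hlt 0 (modelSubmodule M).zero_mem (infinitesimals N).zero_mem
  have hpos' : 0 < σ (ε 1 - ε 0) := by
    have := (equiv_lt_iff σ).2 hpos
    rwa [show σ 0 = 0 from map_zero (equivLinearMap σ)] at this
  change IsLargeInfinitesimal (M : Set N) (x + ε 1 - σ (x + ε 0))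
  rw [e]
  exact ⟨(infinitesimals N).add_mem hinf (equiv_mem_infinitesimals hinf),
    fun d hd hi => (hlt d hd hi).trans (lt_add_of_pos_right _ hpos')⟩

/-- Equality modulo infinitesimals is finer than every invariant relation with stable quotient. -/
theorem infSetoid_le_of_isStableQuotient (hκ : ℵ₀ < κ) (hN : IsSaturated Lloc κ N)
    (hN' : IsStronglyHomogeneous Lloc κ N) (hM : #M < κ)
    (hp : ∀ φ ∈ unrelatedType (M : Set N), Formula.equivSentence φ ∈ p)
    (hF : IsAutInvariant (L := Lloc) (M : Set N) F)
    (hst : IsStableQuotient Lloc κ (M : Set N) F) :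
    (infSetoid N).comap (Subtype.val : realizations p → N) ≤ F := by
  obtain ⟨v, w, hvw, hrel⟩ := exists_rel_of_isStableQuotient hκ hN hN' hM hp hF hst
  intro x y hxy
  have hxy' : (y : N) - x ∈ infinitesimals N := infSetoid_iff.1 hxy
  -- Taking `η` large over `y - x` as well makes both `η` and `η - (y - x)` large over `M`, so `x +
  -- η` is `F`-related to `x` and to `y`.
  obtain ⟨η, hη⟩ := exists_isLargeInfinitesimal hN
    (mk_sup_span_lt hκ (D := modelSubmodule M) hM ((y : N) - x))
  have hz : (x : N) + η ∈ realizations p := mem_realizations_of_isFar hκ hN hN' hM hp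
    ((isFar_of_mem_realizations hp x.2).add_infinitesimal (one_mem_modelSubmodule M) hη.1)
  have key : ∀ t : realizations p, IsLargeInfinitesimal (M : Set N) ((x : N) + η - t) →
      F t ⟨x + η, hz⟩ := fun t ht =>
    rel_of_isLargeInfinitesimal hκ hN hN' hM hp hF (y' := ⟨x + η, hz⟩) hvw ht hrel
  refine F.trans (key x ?_) (F.symm (key y ?_))
  · rw [add_sub_cancel_left]
    exact hη.mono fun c hc => Submodule.mem_sup_left hc
  · rw [show (x : N) + η - y = η - (y - x) by abel]
    refine ⟨(infinitesimals N).sub_mem hη.1 hxy', fun d hd hi => ?_⟩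
    rw [lt_sub_iff_add_lt]
    exact hη.2 _ (Submodule.add_mem _ (Submodule.mem_sup_left hd)
      (Submodule.mem_sup_right (Submodule.mem_span_singleton_self _)))
      ((infinitesimals N).add_mem hi hxy')

/-- `E_A` does not contain equality modulo infinitesimals. -/
lemma not_infSetoid_le_setoidA (hκ : ℵ₀ < κ) (hN : IsSaturated Lloc κ N)
    (hN' : IsStronglyHomogeneous Lloc κ N) (hM : #M < κ)
    (hp : ∀ φ ∈ unrelatedType (M : Set N), Formula.equivSentence φ ∈ p) {A : Set N}
    (hA : ∀ a ∈ A, IsPosInfinitesimal a) (hne : A.Nonempty) :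
    ¬ (infSetoid N).comap (Subtype.val : realizations p → N) ≤
      (setoidA A hA).comap (Subtype.val : realizations p → N) := by
  intro hle
  obtain ⟨a, ha⟩ := hne
  obtain ⟨hinf, hpos⟩ := (hA a ha).mem
  obtain ⟨x, hx⟩ := realizations_nonempty hN hM p
  have hy : x + a ∈ realizations p := mem_realizations_of_isFar hκ hN hN' hM hp
    ((isFar_of_mem_realizations hp hx).add_infinitesimal (one_mem_modelSubmodule M) hinf)
  have h1 : infSetoid N x (x + a) := infSetoid_iff.2 (by rwa [add_sub_cancel_left])
  have h2 : relA A x (x + a) := hle (x := ⟨x, hx⟩) (y := ⟨x + a, hy⟩) h1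
  -- The instance `n = 2` of `E_A` would give `2a ≤ a` although `a > 0`.
  have h3 : 2 • (x + a + -x) ≤ a := ⟨_, (h2 a ha 2 one_le_two).2⟩
  rw [add_assoc, add_comm a, ← add_assoc, add_neg_cancel, zero_add, two_nsmul] at h3
  exact ((lt_add_iff_pos_left a).2 hpos).not_ge h3

lemma aleph0_le_mk_model (M : Lloc.ElementarySubstructure N) : ℵ₀ ≤ #M := by
  rw [Cardinal.aleph0_le_mk_iff]
  refine Infinite.of_injective
    (fun n : ℕ => (⟨(n : ℚ) • one N, (modelSubmodule M).smul_mem _ (one_mem_modelSubmodule M)⟩ : M))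
    fun m n h => ?_
  have h1 : (m : ℚ) • one N = (n : ℚ) • one N := congrArg Subtype.val h
  exact_mod_cast smul_left_injective ℚ loc_one_ne_zero h1

end Finest

end HyperStable

/-! ### The main theorem -/

open HyperStable in
theorem mainTheorem9 {N : Type u} [Lloc.Structure N] [Nonempty N] [N ⊨ Tloc]
    (M : Lloc.ElementarySubstructure N) (κ κ' : Cardinal.{u})
    (hκ : κ.IsStrongLimit) (hκ₀ : ℵ₀ < κ) (hM : IsSaturated Lloc κ M)
    (hκ' : κ'.IsStrongLimit) (hMκ' : #M < κ') (hN : IsSaturated Lloc κ' N)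
    (hN' : IsStronglyHomogeneous Lloc κ' N)
    (p : TypeOver (L := Lloc) (M : Set N))
    (hp : ∀ φ ∈ unrelatedType (M : Set N), Formula.equivSentence φ ∈ p) :
    IsLeast (stableRelations κ κ' M (realizations p))
        ((infSetoid N).comap (Subtype.val : realizations p → N)) ∧
      ∀ (A : Set N) (hA : ∀ a ∈ A, IsPosInfinitesimal a), A.Nonempty → A ⊆ (M : Set N) → #A < κ →
        ¬ IsStableQuotient Lloc κ' (M : Set N)
          ((setoidA A hA).comap (Subtype.val : realizations p → N)) := by
  -- `M` is infinite, as it contains all multiples of `1`. All arguments take place in `N` at level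
  -- `κ'`, where `M` is a small set.
  have hκ₀' : ℵ₀ < κ' := (aleph0_le_mk_model M).trans_lt hMκ'
  refine ⟨⟨⟨⟨∅, Set.empty_subset _, ?_, isRelTypeDefOver_infSetoid _⟩,
    isStableQuotient_infSetoid hκ₀' hN hN' hMκ'⟩, ?_⟩, ?_⟩
  · rw [mk_eq_zero]
    exact aleph0_pos.trans hκ₀
  · rintro F ⟨⟨B, hB, -, hF⟩, hst⟩
    exact infSetoid_le_of_isStableQuotient hκ₀' hN hN' hMκ' hp (hF.isAutInvariant hB) hst
  · intro A hA hne hAM _ hst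
    exact not_infSetoid_le_setoidA hκ₀' hN hN' hMκ' hp hA hne
      (infSetoid_le_of_isStableQuotient hκ₀' hN hN' hMκ' hp
        ((isRelTypeDefOver_setoidA _ hA).isAutInvariant hAM) hst)
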